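/- Identify the quadruple $\{m,n,k,l\}\in\mathbb Z^4$, viewed as the (possibly degenerate) lattice triangle with vertices $(0,0),(m,n),(k,l)$, with the algebraic integer $\alpha=m\zeta^{10}+n\zeta+k\zeta^2+l\zeta^5\in\mathbb Z[\zeta]$, where $\zeta$ is a primitive 12th root of unity; its doubled area is $|nk-ml|$. Let $U$ be the unit group of $\mathbb Z[\zeta]$. The full coset of $\alpha\neq0$ is $\alpha U$, where the four algebraic conjugates of $\alpha$ (which correspond to lattice symmetries of the triangle) are identified; equivalently, it is the set $C(\alpha)=\bigcup_\varphi \varphi(\alpha)U$ over the four ring automorphisms $\varphi$ of $\mathbb Z[\zeta]$. A solution coset of the norm equation $N(\alpha)=r$ is a coset $C(\alpha)$ with $N(\alpha)=r$. An indexation of a coset $C$ lists its triangles as a double-infinite sequence $\alpha(1+\zeta)^j$, $j\in\mathbb Z$, for some $\alpha\in C$ (up to multiplication by powers of $\zeta$ and lattice symmetries, this lists all triangles of $C$). A family is a maximal set of cosets that can be indexed in such a way that, for every $j$, all triangles labelled $j$ have the same area. A set of at least two cosets is of Class B1 if it is maximal with the property that, for a suitable indexation and every $j$, the triangles labelled $j$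 from any two of its cosets have the same area but are not congruent in $\mathbb R^2$; it is of Class B2 if it is maximal with the property that, for a suitable indexation and every $j$, all triangles labelled $j$ have the same area, while some from different cosets are congruent in $\mathbb R^2$ and some others are not. **Theorem 10 (Classes B1, B2).** Let $r=p^{\varrho}$, where $p$ is a prime with $p\equiv1\pmod{12}$ and $\varrho>2$ is an integer. Then the set of solution cosets of $N(\alpha)=r$ is finite, of cardinality $$\sharp(r)=\frac{(\varrho+2)\bigl(2\varrho^2+8\varrho+15+9(-1)^{\varrho}\bigr)}{48},$$ and it is partitioned into $\flat(r)=\lfloor\varrho/2\rfloor+1$ families. One of these families is of Class B1 and not of Class B2; each of the remaining families is of Class B2 and not of Class B1. -/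

import Mathlib

open scoped NumberField

noncomputable section

namespace LatticeTriangles

/-- The cyclotomic field `ℚ(ζ)`, `ζ` a primitive 12-th root of unity. Its ring of integers
`𝓞 K` is `ℤ[ζ]`. -/
abbrev K : Type := CyclotomicField 12 ℚ

instance : IsCyclotomicExtension {12} ℚ K :=
  CyclotomicField.isCyclotomicExtension 12 ℚ

/-- A primitive 12-th root of unity in `K`. -/
def ζ : K := IsCyclotomicExtension.zeta 12 ℚ K

/-- The lattice triangle `{m,n,k,l}`, with vertices `(0,0)`, `(m,n)`, `(k,l)` in `ℤ²`
(degenerate triangles are allowed). -/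
@[ext] structure Triangle where
  m : ℤ
  n : ℤ
  k : ℤ
  l : ℤ

namespace Triangle

/-- The three squared side-lengths, as a multiset. -/
def sqSides (T : Triangle) : Multiset ℤ :=
  {(T.m - T.k) ^ 2 + (T.n - T.l) ^ 2, T.k ^ 2 + T.l ^ 2, T.m ^ 2 + T.n ^ 2}

/-- The doubled area. -/
def area (T : Triangle) : ℤ := |T.n * T.k - T.m * T.l|

/-- Congruence in the Euclidean plane `ℝ²` (side-side-side). -/
def Congr (T T' : Triangle) : Prop := T.sqSides = T'.sqSides

/-- The algebraic number `m ζ¹⁰ + n ζ + k ζ² + l ζ⁵` identified with the triangle. -/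
def toField (T : Triangle) : K :=
  (T.m : K) * ζ ^ 10 + (T.n : K) * ζ + (T.k : K) * ζ ^ 2 + (T.l : K) * ζ ^ 5

end Triangle

/-- The full coset of `α` by the unit group of `ℤ[ζ]`, where the four algebraic conjugates of an
element (they correspond to lattice symmetries of the triangle) are identified:
all products of a conjugate of `α` and a unit. -/
def coset (α : 𝓞 K) : Set (𝓞 K) :=
  {β | ∃ (φ : 𝓞 K ≃+* 𝓞 K) (u : (𝓞 K)ˣ), β = φ α * u}

/-- The full cosets of all nonzero elements. -/
def cosets : Set (Set (𝓞 K)) := {C | ∃ α : 𝓞 K, α ≠ 0 ∧ C = coset α}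

/-- The solution cosets of the norm equation `N(α) = r`. -/
def solutionCosets (r : ℤ) : Set (Set (𝓞 K)) :=
  {C | ∃ α : 𝓞 K, Algebra.norm ℤ α = r ∧ C = coset α}

/-- `T` lists the triangles of the coset `C` as a double-infinite sequence: the `j`-th triangle is
`α (1 + ζ)^j` for some `α` in `C`. As the units are `ζ^i (1 + ζ)^j`, and multiplication by `ζ` does
not change the sides, each triangle of the coset occurs, up to lattice symmetries. -/
def IsIndexation (C : Set (𝓞 K)) (T : ℤ → Triangle) : Prop :=
  ∃ α ∈ C, ∀ j : ℤ, (T j).toField = (α : K) * (1 + ζ) ^ j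

/-- `T` indexes all cosets in `F` so that triangles with the same label have the same area. -/
def IsEqualAreaIndexation (F : Set (Set (𝓞 K))) (T : Set (𝓞 K) → ℤ → Triangle) : Prop :=
  (∀ C ∈ F, IsIndexation C (T C)) ∧
    ∀ C ∈ F, ∀ C' ∈ F, ∀ j : ℤ, (T C j).area = (T C' j).area

/-- All triangles with the same label have the same area, for a suitable indexation. -/
def EqualArea (F : Set (Set (𝓞 K))) : Prop :=
  F ⊆ cosets ∧ ∃ T, IsEqualAreaIndexation F T

/-- A family of cosets: a maximal set of cosets with the equal-area property. -/
def IsFamily (F : Set (Set (𝓞 K))) : Prop := Maximal EqualArea F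

/-- At least two cosets; for each label `j` the triangles labelled `j` in any two of the cosets
have the same area but are not congruent. -/
def EqualAreaNonCongruent (F : Set (Set (𝓞 K))) : Prop :=
  F ⊆ cosets ∧ F.Nontrivial ∧ ∃ T, IsEqualAreaIndexation F T ∧
    ∀ C ∈ F, ∀ C' ∈ F, C ≠ C' → ∀ j : ℤ, ¬ (T C j).Congr (T C' j)

/-- For each label `j` the triangles labelled `j` have the same area; some of them, from different
cosets, are congruent, while some others are not. -/
def EqualAreaPartlyCongruent (F : Set (Set (𝓞 K))) : Prop :=
  F ⊆ cosets ∧ ∃ T, IsEqualAreaIndexation F T ∧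
    ∀ j : ℤ, (∃ C ∈ F, ∃ C' ∈ F, C ≠ C' ∧ (T C j).Congr (T C' j)) ∧
      ∃ C ∈ F, ∃ C' ∈ F, ¬ (T C j).Congr (T C' j)

/-- Class B1. -/
def IsClassB1 (F : Set (Set (𝓞 K))) : Prop := Maximal EqualAreaNonCongruent F

/-- Class B2. -/
def IsClassB2 (F : Set (Set (𝓞 K))) : Prop := Maximal EqualAreaPartlyCongruent F

/-- The families that consist of solution cosets of the norm equation `N(α) = r`. -/
def solutionFamilies (r : ℤ) : Set (Set (Set (𝓞 K))) :=
  {F | IsFamily F ∧ F ⊆ solutionCosets r}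

end LatticeTriangles

end

namespace LatticeTriangles

open scoped NumberField
open Triangle
open Finset.HasAntidiagonal (antidiagonal mem_antidiagonal)

noncomputable section

/-! Put v = m + ni and w = k + li. With i = ζ³, the number attached to a triangle is vζ¹⁰ + wζ², and
its relative norm to ℤ[√3] is H − A√3, where H is half the sum of the squared sides and A the signed
doubled area (`relNorm_toInt`). Everything rests on reading area and congruence off this
description.

Areas: multiplication by 1 + ζ multiplies the relative norm by 2 + √3, and it strictly lowers A.
Hence equal areas for all labels force equal relative norms (`relNorm_eq_of_area_eq`), and the
family of α consists of the cosets that contain an element with the relative norm of α.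

Congruence: triangles with the same sides differ, up to automorphisms and units, by a Gaussian
number of modulus 1 (`gaussRelated_of_congr`). Conversely, such a factor preserves the sides
(`sides_eq_of_mul_conj_eq`).

Arithmetic: ℤ[ζ] is principal and p splits into four pairwise non-associated conjugate primes.
Solutions of N(α) = p^ρ are therefore, up to units, monomials in these primes with exponents
((a,b),(c,d)) of sum ρ, and cosets are the orbits of a Klein four-group on the exponents. The family
is given by the unordered pair {a+b, c+d}, whence ⌊ρ/2⌋ + 1 families. A Gaussian factor of modulus 1
changes the exponents by (t,−t,t,−t) (`exps_of_gaussRelated`). If c + d = 0, no nonzero shift is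
possible, which gives Class B1. If both sums are positive, one shift yields two congruent cosets,
while the invariant |(a−b) − (c−d)| separates others, which gives Class B2. The number of cosets
follows by counting fixed points (Burnside). -/

/-! ### Triangle coordinates on ℤ[ζ] and its automorphisms -/

/-- The root of unity `ζ` as an element of `ℤ[ζ]`. -/
def z : 𝓞 K := (IsCyclotomicExtension.zeta_spec 12 ℚ K).toInteger

lemma coe_z : (z : K) = ζ := rfl

lemma z_isPrimitiveRoot : IsPrimitiveRoot z 12 :=
  (IsCyclotomicExtension.zeta_spec 12 ℚ K).toInteger_isPrimitiveRoot

lemma z_pow_four : z ^ 4 = z ^ 2 - 1 := by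
  have h := z_isPrimitiveRoot
  have h12 := h.pow_eq_one
  have h6 : z ^ 6 - 1 ≠ 0 := sub_ne_zero.mpr (h.pow_ne_one_of_pos_of_lt (by norm_num) (by norm_num))
  have h4 : z ^ 4 - 1 ≠ 0 := sub_ne_zero.mpr (h.pow_ne_one_of_pos_of_lt (by norm_num) (by norm_num))
  have h2 : z ^ 2 + 1 ≠ 0 := fun h0 => h4 (by linear_combination (z ^ 2 - 1) * h0)
  have e : (z ^ 6 - 1) * ((z ^ 2 + 1) * (z ^ 4 - z ^ 2 + 1)) = 0 := by linear_combination h12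
  have := (mul_eq_zero.mp ((mul_eq_zero.mp e).resolve_left h6)).resolve_left h2
  linear_combination this

namespace Triangle

/-- The algebraic integer identified with the triangle. -/
def toInt (T : Triangle) : 𝓞 K := T.m * z ^ 10 + T.n * z + T.k * z ^ 2 + T.l * z ^ 5

lemma coe_toInt (T : Triangle) : (T.toInt : K) = T.toField := by
  simp [toInt, toField, coe_z]

/-- Half the sum of the squared sides. -/
def halfSum (T : Triangle) : ℤ := T.m ^ 2 + T.n ^ 2 + T.k ^ 2 + T.l ^ 2 - (T.m * T.k + T.n * T.l)

/-- The signed doubled area. -/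
def signedArea (T : Triangle) : ℤ := T.m * T.l - T.n * T.k

lemma two_mul_halfSum (T : Triangle) : 2 * T.halfSum =
    T.m ^ 2 + T.n ^ 2 + T.k ^ 2 + T.l ^ 2 + (T.m - T.k) ^ 2 + (T.n - T.l) ^ 2 := by
  unfold halfSum; ring

lemma halfSum_nonneg (T : Triangle) : 0 ≤ T.halfSum := by
  have : 0 ≤ 2 * T.halfSum := by rw [two_mul_halfSum]; positivity
  lia

lemma eq_zero_of_halfSum (T : Triangle) (h : T.halfSum = 0) : T = ⟨0, 0, 0, 0⟩ := by
  have e := two_mul_halfSum T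
  have h1 := sq_nonneg T.m
  have h2 := sq_nonneg T.n
  have h3 := sq_nonneg T.k
  have h4 := sq_nonneg T.l
  have h5 := sq_nonneg (T.m - T.k)
  have h6 := sq_nonneg (T.n - T.l)
  ext <;> exact pow_eq_zero_iff (two_ne_zero) |>.mp (by lia)

/-- The norm form is a sum of two squares. -/
lemma norm_form_nonneg (T : Triangle) : 0 ≤ T.halfSum ^ 2 - 3 * T.signedArea ^ 2 := by
  -- Up to sign, the squared terms are the real and imaginary parts of v² − vw + w², the relative
  -- norm to ℤ[i].
  have : T.halfSum ^ 2 - 3 * T.signedArea ^ 2 =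
      (T.n ^ 2 - T.m ^ 2 + (T.l ^ 2 - T.k ^ 2) - (T.n * T.l - T.m * T.k)) ^ 2 +
      (2 * T.m * T.n + 2 * T.k * T.l - (T.n * T.k + T.m * T.l)) ^ 2 := by
    unfold halfSum signedArea; ring
  rw [this]; positivity

end Triangle

lemma toInt_surjective : Function.Surjective Triangle.toInt := by
  intro x
  let B := (IsCyclotomicExtension.zeta_spec 12 ℚ K).integralPowerBasis
  have hd : B.dim = 4 := by
    rw [show B.dim = Nat.totient 12 from IsPrimitiveRoot.integralPowerBasis_dim _]; decide
  have hg : B.gen = z := IsPrimitiveRoot.integralPowerBasis_gen _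
  have h := B.basis.sum_repr x
  have h' : x = ∑ i : Fin 4, (B.basis.repr x (Fin.cast hd.symm i)) • z ^ (i : ℕ) := by
    conv_lhs => rw [← h, ← (finCongr hd.symm).sum_comp]
    simp [hg]
  rw [Fin.sum_univ_four] at h'
  simp only [zsmul_eq_mul] at h'
  generalize B.basis.repr x (Fin.cast hd.symm 0) = a at h'
  generalize B.basis.repr x (Fin.cast hd.symm 1) = b at h'
  generalize B.basis.repr x (Fin.cast hd.symm 2) = c at h'
  generalize B.basis.repr x (Fin.cast hd.symm 3) = d at h'
  -- Solves m = a, n − l = b, k − m = c, l = d, the coordinates in the basis 1, ζ, ζ², ζ³.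
  refine ⟨⟨a, b + d, a + c, d⟩, ?_⟩
  rw [h']
  simp only [toInt, Fin.val_zero, Fin.val_one, Fin.val_two, show ((3 : Fin 4) : ℕ) = 3 from rfl]
  push_cast
  linear_combination ((a : 𝓞 K) * (z ^ 6 + z ^ 4 - 1) + d * z) * z_pow_four

lemma ringHom_ext {A : Type*} [Ring A] {f g : 𝓞 K →+* A} (h : f z = g z) : f = g := by
  ext x
  obtain ⟨T, rfl⟩ := toInt_surjective x
  simp [toInt, h]

/-- The automorphism of `ℤ[ζ]` with `ζ ↦ ζ ^ a`. -/
def galAut (a : (ZMod 12)ˣ) : 𝓞 K ≃+* 𝓞 K :=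
  NumberField.RingOfIntegers.mapRingEquiv
    ((IsCyclotomicExtension.Rat.galEquivZMod 12 K).symm a).toRingEquiv

lemma galAut_z (a : (ZMod 12)ˣ) : galAut a z = z ^ (a : ZMod 12).val := by
  apply NumberField.RingOfIntegers.ext
  have h : (z : K) ^ 12 = 1 := by
    have := congrArg (algebraMap (𝓞 K) K) z_isPrimitiveRoot.pow_eq_one
    simpa using this
  have := IsCyclotomicExtension.Rat.galEquivZMod_apply_of_pow_eq 12 K
    ((IsCyclotomicExtension.Rat.galEquivZMod 12 K).symm a) h
  rw [MulEquiv.apply_symm_apply] at this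
  simpa using! this

/-- Complex conjugation. -/
def conj : 𝓞 K ≃+* 𝓞 K := galAut ⟨11, 11, by decide, by decide⟩

/-- The nontrivial automorphism over `ℤ[i]`. -/
def swap : 𝓞 K ≃+* 𝓞 K := galAut ⟨5, 5, by decide, by decide⟩

lemma conj_z : conj z = z ^ 11 := galAut_z _

lemma swap_z : swap z = z ^ 5 := galAut_z _

lemma z_pow_twelve : z ^ 12 = 1 := z_isPrimitiveRoot.pow_eq_one

@[simp] lemma conj_conj (x : 𝓞 K) : conj (conj x) = x := by
  have : (conj.toRingHom.comp conj.toRingHom) = RingHom.id _ := ringHom_ext (by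
    simp only [RingEquiv.toRingHom_eq_coe, RingHom.comp_apply, RingHom.coe_coe, conj_z, map_pow,
      RingHom.id_apply, ← pow_mul]
    calc z ^ (11 * 11) = (z ^ 12) ^ 10 * z := by ring
      _ = z := by rw [z_pow_twelve]; ring)
  exact congrArg (fun f : 𝓞 K →+* 𝓞 K => f x) this

@[simp] lemma swap_swap (x : 𝓞 K) : swap (swap x) = x := by
  have : (swap.toRingHom.comp swap.toRingHom) = RingHom.id _ := ringHom_ext (by
    simp only [RingEquiv.toRingHom_eq_coe, RingHom.comp_apply, RingHom.coe_coe, swap_z, map_pow,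
      RingHom.id_apply, ← pow_mul]
    calc z ^ (5 * 5) = (z ^ 12) ^ 2 * z := by ring
      _ = z := by rw [z_pow_twelve]; ring)
  exact congrArg (fun f : 𝓞 K →+* 𝓞 K => f x) this

lemma swap_conj (x : 𝓞 K) : swap (conj x) = conj (swap x) := by
  have : (swap.toRingHom.comp conj.toRingHom) = conj.toRingHom.comp swap.toRingHom := ringHom_ext (by
    simp only [RingEquiv.toRingHom_eq_coe, RingHom.comp_apply, RingHom.coe_coe, swap_z, map_pow,
      conj_z, ← pow_mul])
  exact congrArg (fun f : 𝓞 K →+* 𝓞 K => f x) this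

lemma ringEquiv_cases (φ : 𝓞 K ≃+* 𝓞 K) :
    (∀ x, φ x = x) ∨ (∀ x, φ x = conj x) ∨ (∀ x, φ x = swap x) ∨ ∀ x, φ x = conj (swap x) := by
  have h := z_isPrimitiveRoot.map_of_injective (f := φ) φ.injective
  obtain ⟨i, hi, hc, he⟩ := z_isPrimitiveRoot.isPrimitiveRoot_iff.mp h
  have key : ∀ f : 𝓞 K →+* 𝓞 K, f z = z ^ i → ∀ x, φ x = f x := fun f hf x => by
    have : φ.toRingHom = f := ringHom_ext (by simp [hf, ← he])
    rw [← this]; rfl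
  have hi' : i = 1 ∨ i = 11 ∨ i = 5 ∨ i = 7 := by
    interval_cases i <;> revert hc <;> decide
  rcases hi' with rfl | rfl | rfl | rfl
  · exact Or.inl (key (RingHom.id _) (by simp))
  · exact Or.inr (Or.inl (key conj.toRingHom (by simp [conj_z])))
  · exact Or.inr (Or.inr (Or.inl (key swap.toRingHom (by simp [swap_z]))))
  · refine Or.inr (Or.inr (Or.inr (key (conj.toRingHom.comp swap.toRingHom) ?_)))
    simp only [RingEquiv.toRingHom_eq_coe, RingHom.comp_apply, RingHom.coe_coe, swap_z, map_pow,
      conj_z, ← pow_mul]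
    calc z ^ (11 * 5) = (z ^ 12) ^ 4 * z ^ 7 := by ring
      _ = z ^ 7 := by rw [z_pow_twelve]; ring

/-! ### The relative norm to ℤ[√3]: side lengths and area -/

/-- The square root of `3` in `ℤ[ζ]`. -/
def sqrtThree : 𝓞 K := 2 * z - z ^ 3

lemma sqrtThree_sq : sqrtThree ^ 2 = 3 := by
  unfold sqrtThree
  linear_combination (z ^ 2 - 3) * z_pow_four

lemma conj_z' : conj z = z - z ^ 3 := by
  rw [conj_z]
  linear_combination (z ^ 7 + z ^ 5 - z) * z_pow_four

lemma swap_z' : swap z = z ^ 3 - z := by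
  rw [swap_z]
  linear_combination z * z_pow_four

lemma swap_sqrtThree : swap sqrtThree = -sqrtThree := by
  simp only [sqrtThree, map_sub, map_mul, map_ofNat, map_pow, swap_z']
  linear_combination -(z ^ 5 - 2 * z ^ 3) * z_pow_four

/-- The relative norm to `ℤ[√3]`. -/
def relNorm (x : 𝓞 K) : 𝓞 K := x * conj x

lemma relNorm_mul (x y : 𝓞 K) : relNorm (x * y) = relNorm x * relNorm y := by
  simp only [relNorm, map_mul]; ring

lemma relNorm_conj (x : 𝓞 K) : relNorm (conj x) = relNorm x := by
  simp only [relNorm, conj_conj]; ring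

lemma relNorm_swap (x : 𝓞 K) : relNorm (swap x) = swap (relNorm x) := by
  simp only [relNorm, map_mul, swap_conj]

lemma toInt_eq (T : Triangle) :
    T.toInt = T.m + (T.n - T.l) * z + (T.k - T.m) * z ^ 2 + T.l * z ^ 3 := by
  rw [toInt]
  linear_combination ((T.m : 𝓞 K) * (z ^ 6 + z ^ 4 - 1) + T.l * z) * z_pow_four

/-- The bridge between geometry and arithmetic. The product is symmetric in z and its conjugate up
to the coefficients, so its expansion needs only their product 1, their sum √3, and the power sums 1
and 0 of degrees two and three. -/
lemma relNorm_toInt (T : Triangle) :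
    relNorm T.toInt = T.halfSum - T.signedArea * sqrtThree := by
  have h1 : z * conj z = 1 := by rw [conj_z']; linear_combination -z_pow_four
  have h2 : z ^ 2 + conj z ^ 2 = 1 := by
    rw [conj_z']; linear_combination (z ^ 2 - 1) * z_pow_four
  have h3 : z ^ 3 + conj z ^ 3 = 0 := by
    rw [conj_z']; linear_combination (-z ^ 5 + 2 * z ^ 3) * z_pow_four
  have hs : sqrtThree = z + conj z := by rw [conj_z', sqrtThree]; ring
  simp only [relNorm, toInt_eq, halfSum, signedArea, map_add, map_sub, map_mul, map_pow,
    map_intCast]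
  rw [hs]
  generalize conj z = w at *
  push_cast
  obtain ⟨m, n, k, l⟩ := T
  dsimp only
  generalize (m : 𝓞 K) = m
  generalize (n : 𝓞 K) = n
  generalize (k : 𝓞 K) = k
  generalize (l : 𝓞 K) = l
  linear_combination ((n - l) ^ 2 + (k - m) ^ 2 * (z * w + 1) +
    l ^ 2 * (z ^ 2 * w ^ 2 + z * w + 1) + (n - l) * (k - m) * (z + w) +
    (n - l) * l * (z ^ 2 + w ^ 2) + (k - m) * l * (z + w) * (z * w + 1)) * h1 +
    (m * (k - m) + (n - l) * l) * h2 + m * l * h3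

lemma int_eq_zero_of_sq_eq (x y : ℤ) (h : x ^ 2 = 3 * y ^ 2) : x = 0 ∧ y = 0 := by
  by_contra hxy
  have hy : y ≠ 0 := by
    rintro rfl
    simp_all
  have hirr : Irrational (√3 : ℝ) := by simpa using Nat.Prime.irrational_sqrt Nat.prime_three
  apply hirr
  refine ⟨|(x : ℚ) / y|, ?_⟩
  have hyR : (y : ℝ) ≠ 0 := by exact_mod_cast hy
  have hR : (x : ℝ) ^ 2 = 3 * y ^ 2 := by exact_mod_cast h
  push_cast
  rw [← Real.sqrt_sq_eq_abs, div_pow, hR]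
  congr 1
  field_simp

lemma add_mul_sqrtThree_inj {a b a' b' : ℤ}
    (h : (a : 𝓞 K) - b * sqrtThree = a' - b' * sqrtThree) : a = a' ∧ b = b' := by
  have h' : ((a - a' : ℤ) : 𝓞 K) = ((b - b' : ℤ) : 𝓞 K) * sqrtThree := by
    push_cast; linear_combination h
  have : (((a - a') ^ 2 : ℤ) : 𝓞 K) = ((3 * (b - b') ^ 2 : ℤ) : 𝓞 K) := by
    have e := congrArg (· ^ 2) h'
    simp only [mul_pow, sqrtThree_sq] at e
    push_cast at e ⊢
    linear_combination e
  have := int_eq_zero_of_sq_eq _ _ (Int.cast_injective this)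
  lia

lemma toInt_injective : Function.Injective Triangle.toInt := by
  intro T T' h
  let D : Triangle := ⟨T.m - T'.m, T.n - T'.n, T.k - T'.k, T.l - T'.l⟩
  have hD : D.toInt = 0 := by
    have : D.toInt = T.toInt - T'.toInt := by simp only [toInt, D]; push_cast; ring
    rw [this, h, sub_self]
  have h0 := relNorm_toInt D
  rw [hD, show relNorm 0 = ((0 : ℤ) : 𝓞 K) - (0 : ℤ) * sqrtThree by simp [relNorm]] at h0
  have := eq_zero_of_halfSum D (add_mul_sqrtThree_inj h0).1.symm
  simp only [D, Triangle.mk.injEq] at this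
  ext <;> lia

/-- The triangle identified with an algebraic integer. -/
def tri : 𝓞 K ≃ Triangle := (Equiv.ofBijective _ ⟨toInt_injective, toInt_surjective⟩).symm

@[simp] lemma tri_toInt (T : Triangle) : tri T.toInt = T :=
  (Equiv.ofBijective _ ⟨toInt_injective, toInt_surjective⟩).symm_apply_apply T

@[simp] lemma toInt_tri (x : 𝓞 K) : (tri x).toInt = x :=
  (Equiv.ofBijective _ ⟨toInt_injective, toInt_surjective⟩).apply_symm_apply x

lemma eq_tri_of_toField {T : Triangle} {x : 𝓞 K} (h : T.toField = x) : T = tri x := by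
  rw [← coe_toInt] at h
  rw [← NumberField.RingOfIntegers.ext h, tri_toInt]

lemma relNorm_eq (x : 𝓞 K) :
    relNorm x = (tri x).halfSum - (tri x).signedArea * sqrtThree := by
  rw [← relNorm_toInt, toInt_tri]

lemma relNorm_eq_iff (x y : 𝓞 K) : relNorm x = relNorm y ↔
    (tri x).halfSum = (tri y).halfSum ∧ (tri x).signedArea = (tri y).signedArea := by
  rw [relNorm_eq, relNorm_eq]
  exact ⟨add_mul_sqrtThree_inj, fun h => by rw [h.1, h.2]⟩

lemma halfSum_pos {x : 𝓞 K} (hx : x ≠ 0) : 0 < (tri x).halfSum := by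
  refine lt_of_le_of_ne (halfSum_nonneg _) fun h => hx ?_
  rw [← toInt_tri x, eq_zero_of_halfSum _ h.symm]
  simp [toInt]

lemma abs_signedArea_lt {x : 𝓞 K} (hx : x ≠ 0) : |(tri x).signedArea| < (tri x).halfSum := by
  have h := norm_form_nonneg (tri x)
  have h0 := halfSum_pos hx
  by_contra! hc
  have := pow_le_pow_left₀ h0.le hc 2
  rw [sq_abs] at this
  nlinarith

/-- Here H = 1 and A = 0. As 2H is a sum of squares, all coordinates lie in {−1, 0, 1}, and a finite
check leaves the twelve roots of unity. -/
lemma exists_pow_z_of_relNorm_eq_one {w : 𝓞 K} (h : relNorm w = 1) : ∃ i : ℕ, w = z ^ i := by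
  rw [relNorm_eq, show (1 : 𝓞 K) = ((1 : ℤ) : 𝓞 K) - (0 : ℤ) * sqrtThree by simp] at h
  obtain ⟨h1, h2⟩ := add_mul_sqrtThree_inj h
  rw [← toInt_tri w]
  generalize tri w = T at *
  have e := two_mul_halfSum T
  rw [h1] at e
  have := sq_nonneg T.m
  have := sq_nonneg T.n
  have := sq_nonneg T.k
  have := sq_nonneg T.l
  have := sq_nonneg (T.m - T.k)
  have := sq_nonneg (T.n - T.l)
  have bound : ∀ a : ℤ, a ^ 2 ≤ 2 → a = -1 ∨ a = 0 ∨ a = 1 := fun a ha => by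
    have h1 : a < 2 := by nlinarith
    have h2 : -2 < a := by nlinarith
    lia
  have bm := bound T.m (by lia)
  have bn := bound T.n (by lia)
  have bk := bound T.k (by lia)
  have bl := bound T.l (by lia)
  have hz : ∀ T : Triangle, T ∈ ([⟨1, 0, 1, 0⟩, ⟨0, 1, 0, 0⟩, ⟨0, 0, 1, 0⟩, ⟨0, 1, 0, 1⟩,
      ⟨-1, 0, 0, 0⟩, ⟨0, 0, 0, 1⟩, ⟨-1, 0, -1, 0⟩, ⟨0, -1, 0, 0⟩, ⟨0, 0, -1, 0⟩, ⟨0, -1, 0, -1⟩,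
      ⟨1, 0, 0, 0⟩, ⟨0, 0, 0, -1⟩] : List Triangle) → ∃ i : ℕ, T.toInt = z ^ i := by
    have h6 : z ^ 6 = -1 := by linear_combination (z ^ 2 + 1) * z_pow_four
    intro T hT
    simp only [List.mem_cons, List.not_mem_nil, or_false] at hT
    rcases hT with rfl | rfl | rfl | rfl | rfl | rfl | rfl | rfl | rfl | rfl | rfl | rfl
    · exact ⟨0, by simp [toInt_eq]⟩
    · exact ⟨1, by simp [toInt_eq]⟩
    · exact ⟨2, by simp [toInt_eq]⟩
    · exact ⟨3, by simp [toInt_eq]⟩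
    · exact ⟨4, by simp [toInt_eq, z_pow_four]; ring⟩
    · exact ⟨5, by simp [toInt]⟩
    · exact ⟨6, by simp [toInt_eq, h6]⟩
    · exact ⟨7, by simp [toInt_eq, pow_succ z 6, h6]⟩
    · exact ⟨8, by simp [toInt_eq, pow_add z 6 2, h6]⟩
    · exact ⟨9, by simp [toInt_eq, pow_add z 6 3, h6]⟩
    · exact ⟨10, by simp [toInt]⟩
    · exact ⟨11, by simp [toInt, pow_add z 6 5, h6]⟩
  apply hz
  obtain ⟨m, n, k, l⟩ := T
  simp only [halfSum, signedArea] at h1 h2 bm bn bk bl ⊢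
  rcases bm with rfl | rfl | rfl <;> rcases bn with rfl | rfl | rfl <;>
  rcases bk with rfl | rfl | rfl <;> rcases bl with rfl | rfl | rfl <;> simp at h1 h2 ⊢

/-- The absolute norm in terms of the relative norm. -/
lemma coe_norm (x : 𝓞 K) :
    ((Algebra.norm ℤ x : ℤ) : 𝓞 K) = relNorm x * swap (relNorm x) := by
  apply NumberField.RingOfIntegers.ext
  have : IsGalois ℚ K := IsCyclotomicExtension.isGalois {12} ℚ K
  have h1 : ((Algebra.norm ℤ x : ℤ) : K) = algebraMap ℚ K (Algebra.norm ℚ (x : K)) := by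
    rw [← Algebra.coe_norm_int]; simp
  have h2 := Algebra.norm_eq_prod_automorphisms ℚ (x : K)
  rw [← (IsCyclotomicExtension.Rat.galEquivZMod 12 K).symm.toEquiv.prod_comp] at h2
  have hu : (Finset.univ : Finset (ZMod 12)ˣ) = {1, ⟨11, 11, by decide, by decide⟩,
    ⟨5, 5, by decide, by decide⟩, ⟨7, 7, by decide, by decide⟩} := by decide
  rw [hu, Finset.prod_insert (by decide), Finset.prod_insert (by decide),
    Finset.prod_insert (by decide), Finset.prod_singleton] at h2
  have h7 : galAut ⟨7, 7, by decide, by decide⟩ x = conj (swap x) := by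
    rw [conj, swap, galAut, galAut, galAut]
    apply NumberField.RingOfIntegers.ext
    simp only [NumberField.RingOfIntegers.mapRingEquiv_apply, AlgEquiv.coe_ringEquiv]
    rw [← AlgEquiv.mul_apply, ← map_mul]
    congr 2
  have h8 : algebraMap ℚ K (Algebra.norm ℚ (x : K)) =
      ((x * (conj x * (swap x * conj (swap x))) : 𝓞 K) : K) := by
    rw [h2, ← h7]
    simp only [map_mul]
    congr 1
    rw [show (IsCyclotomicExtension.Rat.galEquivZMod 12 K).symm.toEquiv 1 = 1 from
      map_one (IsCyclotomicExtension.Rat.galEquivZMod 12 K).symm]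
    rfl
  have h9 : relNorm x * swap (relNorm x) = x * (conj x * (swap x * conj (swap x))) := by
    rw [relNorm, map_mul, swap_conj]
    ring
  rw [h9, ← h8, ← h1]
  simp

open Triangle

/-! ### The unit 1 + ζ and equality of areas -/

lemma z_pow_six : z ^ 6 = -1 := by linear_combination (z ^ 2 + 1) * z_pow_four

/-- The fundamental unit `1 + ζ`. -/
def onePlusZ : (𝓞 K)ˣ where
  val := 1 + z
  inv := (1 + z ^ 5) * z ^ 9
  val_inv := by linear_combination (z ^ 2 + z + 1) * z ^ 9 * z_pow_four + z_pow_twelve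
  inv_val := by linear_combination (z ^ 2 + z + 1) * z ^ 9 * z_pow_four + z_pow_twelve

lemma relNorm_onePlusZ : relNorm (onePlusZ : 𝓞 K) = 2 + sqrtThree := by
  simp only [relNorm, onePlusZ, map_add, map_one, conj_z', sqrtThree]
  linear_combination -z_pow_four

lemma tri_mul_onePlusZ (x : 𝓞 K) :
    (tri (x * onePlusZ)).halfSum = 2 * (tri x).halfSum - 3 * (tri x).signedArea ∧
    (tri (x * onePlusZ)).signedArea = 2 * (tri x).signedArea - (tri x).halfSum := by
  apply add_mul_sqrtThree_inj
  rw [← relNorm_eq, relNorm_mul, relNorm_onePlusZ, relNorm_eq]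
  push_cast
  linear_combination -((tri x).signedArea : 𝓞 K) * sqrtThree_sq

lemma area_eq_abs (T : Triangle) : T.area = |T.signedArea| := abs_sub_comm _ _

/-- Each factor 1 + ζ replaces A by 2A − H, and A < H for nonzero elements. -/
lemma signedArea_le (x : 𝓞 K) (hx : x ≠ 0) (n : ℕ) :
    (tri (x * onePlusZ ^ n)).signedArea ≤ (tri x).signedArea - n := by
  induction n with
  | zero => simp
  | succ n ih =>
    have hne : x * (onePlusZ : 𝓞 K) ^ n ≠ 0 := mul_ne_zero hx (pow_ne_zero _ onePlusZ.ne_zero)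
    have h1 := abs_lt.mp (abs_signedArea_lt hne)
    rw [pow_succ, ← mul_assoc, (tri_mul_onePlusZ _).2]
    push_cast
    lia

lemma relNorm_eq_of_area_eq {x y : 𝓞 K} (hx : x ≠ 0) (hy : y ≠ 0)
    (h : ∀ n : ℕ, (tri (x * onePlusZ ^ n)).area = (tri (y * onePlusZ ^ n)).area) :
    relNorm x = relNorm y := by
  simp only [area_eq_abs] at h
  -- From this label on both signed areas are nonpositive, so equal areas mean equal signed areas.
  let N := (tri x).signedArea.natAbs + (tri y).signedArea.natAbs
  have eq : ∀ n, N ≤ n → (tri (x * onePlusZ ^ n)).signedArea =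
      (tri (y * onePlusZ ^ n)).signedArea := fun n hn => by
    have h1 := signedArea_le x hx n
    have h2 := signedArea_le y hy n
    have h3 := h n
    rw [abs_of_nonpos (by lia), abs_of_nonpos (by lia)] at h3
    lia
  have e0 := eq N le_rfl
  -- The next signed area is 2A − H, so two consecutive ones determine H as well.
  have e1 := eq (N + 1) (by lia)
  rw [pow_succ, ← mul_assoc, ← mul_assoc, (tri_mul_onePlusZ _).2, (tri_mul_onePlusZ _).2] at e1
  have := (relNorm_eq_iff (x * onePlusZ ^ N) (y * onePlusZ ^ N)).mpr ⟨by lia, e0⟩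
  rw [relNorm_mul, relNorm_mul] at this
  refine mul_right_cancel₀ ?_ this
  rw [relNorm]
  have : (onePlusZ : 𝓞 K) ^ N ≠ 0 := pow_ne_zero _ onePlusZ.ne_zero
  exact mul_ne_zero this ((map_ne_zero_iff _ conj.injective).mpr this)

lemma relNorm_ne_zero {x : 𝓞 K} (hx : x ≠ 0) : relNorm x ≠ 0 :=
  mul_ne_zero hx ((map_ne_zero_iff _ conj.injective).mpr hx)

/-! ### Congruence of triangles and Gaussian numbers of modulus 1 -/

/-- Multiplication of a triangle by the Gaussian integer `a + b i`. -/
def gaussMul (a b : ℤ) (T : Triangle) : Triangle :=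
  ⟨a * T.m - b * T.n, a * T.n + b * T.m, a * T.k - b * T.l, a * T.l + b * T.k⟩

/-- The Gaussian integer `a + b i`. -/
def gauss (a b : ℤ) : 𝓞 K := a + b * z ^ 3

lemma toInt_gaussMul (a b : ℤ) (T : Triangle) :
    (gaussMul a b T).toInt = gauss a b * T.toInt := by
  simp only [toInt, gaussMul, gauss]
  push_cast
  linear_combination b * (-(T.n * (z ^ 6 + z ^ 4 - 1)) - T.n - T.l * (z ^ 4 + z ^ 2) -
    T.m * (z ^ 9 + z ^ 7 - z ^ 3 - z)) * z_pow_four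

lemma gauss_conj (a b : ℤ) : conj (gauss a b) = gauss a (-b) := by
  simp only [gauss, map_add, map_mul, map_pow, map_intCast, conj_z']
  push_cast
  linear_combination b * (-z ^ 5 + 2 * z ^ 3) * z_pow_four

lemma gauss_swap (a b : ℤ) : swap (gauss a b) = gauss a b := by
  simp only [gauss, map_add, map_mul, map_pow, map_intCast, swap_z']
  linear_combination b * (z ^ 5 - 2 * z ^ 3) * z_pow_four

lemma relNorm_gauss (a b : ℤ) : relNorm (gauss a b) = ((a ^ 2 + b ^ 2 : ℤ) : 𝓞 K) := by
  rw [relNorm, gauss_conj]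
  simp only [gauss]
  push_cast
  linear_combination -(b : 𝓞 K) ^ 2 * z_pow_six

lemma tri_z_mul (T : Triangle) : tri (z * T.toInt) = ⟨-T.l, T.k, T.n - T.l, T.k - T.m⟩ := by
  rw [← tri_toInt ⟨-T.l, T.k, T.n - T.l, T.k - T.m⟩]
  congr 1
  simp only [toInt_eq]
  push_cast
  linear_combination T.l * z_pow_four

lemma tri_conj (T : Triangle) : tri (conj T.toInt) = ⟨T.k, -T.l, T.m, -T.n⟩ := by
  rw [← tri_toInt ⟨T.k, -T.l, T.m, -T.n⟩]
  congr 1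
  simp only [toInt_eq, map_add, map_sub, map_mul, map_pow, map_intCast, conj_z']
  push_cast
  linear_combination ((T.k - T.m) * (z ^ 2 - 1) + T.l * (-z ^ 5 + 2 * z ^ 3)) * z_pow_four

lemma tri_swap (T : Triangle) : tri (swap T.toInt) = ⟨T.k, T.l, T.m, T.n⟩ := by
  rw [← tri_toInt ⟨T.k, T.l, T.m, T.n⟩]
  congr 1
  simp only [toInt_eq, map_add, map_sub, map_mul, map_pow, map_intCast, swap_z']
  linear_combination ((T.k - T.m) * (z ^ 2 - 1) + T.l * (z ^ 5 - 2 * z ^ 3)) * z_pow_four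

lemma exists_eq_gauss {q : 𝓞 K} (hq : swap q = q) : ∃ a b : ℤ, q = gauss a b := by
  have h := tri_swap (tri q)
  rw [toInt_tri, hq] at h
  refine ⟨(tri q).m, (tri q).n, ?_⟩
  have h1 := congrArg Triangle.m h
  have h2 := congrArg Triangle.n h
  dsimp only at h1 h2
  conv_lhs => rw [← toInt_tri q, toInt_eq]
  rw [gauss, ← h1, ← h2]
  ring

/-- The multiset of squared sides of the triangle of an algebraic integer. -/
def sides (x : 𝓞 K) : Multiset ℤ := (tri x).sqSides

/-- Multiplication by z sends (v, w) to (iw, i(w − v)): it permutes the side vectors up to a quarter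
turn and signs. -/
lemma sides_z_mul (x : 𝓞 K) : sides (z * x) = sides x := by
  obtain ⟨T, rfl⟩ := toInt_surjective x
  simp only [sides, tri_z_mul, tri_toInt, sqSides]
  rw [show (-T.l - (T.n - T.l)) ^ 2 + (T.k - (T.k - T.m)) ^ 2 = T.m ^ 2 + T.n ^ 2 by ring,
    show (T.n - T.l) ^ 2 + (T.k - T.m) ^ 2 = (T.m - T.k) ^ 2 + (T.n - T.l) ^ 2 by ring,
    show (-T.l) ^ 2 + T.k ^ 2 = T.k ^ 2 + T.l ^ 2 by ring]
  simp only [Multiset.insert_eq_cons]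
  rw [Multiset.cons_swap]
  congr 1
  exact Multiset.pair_comm _ _

lemma sides_z_pow_mul (i : ℕ) (x : 𝓞 K) : sides (z ^ i * x) = sides x := by
  induction i with
  | zero => simp
  | succ i ih => rw [pow_succ', mul_assoc, sides_z_mul, ih]

lemma sides_conj (x : 𝓞 K) : sides (conj x) = sides x := by
  obtain ⟨T, rfl⟩ := toInt_surjective x
  simp only [sides, tri_conj, tri_toInt, sqSides]
  rw [show (T.k - T.m) ^ 2 + (-T.l - -T.n) ^ 2 = (T.m - T.k) ^ 2 + (T.n - T.l) ^ 2 by ring,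
    neg_sq, neg_sq]
  simp only [Multiset.insert_eq_cons]
  congr 1
  exact Multiset.pair_comm _ _

lemma sides_gauss_mul (a b : ℤ) (x : 𝓞 K) :
    sides (gauss a b * x) = (sides x).map ((a ^ 2 + b ^ 2) * ·) := by
  obtain ⟨T, rfl⟩ := toInt_surjective x
  simp only [sides, ← toInt_gaussMul, tri_toInt, sqSides, gaussMul, Multiset.insert_eq_cons,
    Multiset.map_cons, Multiset.map_singleton]
  congr 1
  · ring
  congr 1
  · ring
  congr 1
  ring

/-- Multiplying by a Gaussian number of modulus `1` does not change the sides. -/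
lemma sides_eq_of_mul_conj_eq {x y q w : 𝓞 K} (hq : swap q = q) (hq0 : q ≠ 0)
    (hw : relNorm w = 1) (h : x * conj q = q * y * w) : sides x = sides y := by
  obtain ⟨a, b, rfl⟩ := exists_eq_gauss hq
  obtain ⟨i, rfl⟩ := exists_pow_z_of_relNorm_eq_one hw
  have h1 : gauss a (-b) * x = z ^ i * (gauss a b * y) := by
    rw [← gauss_conj]; linear_combination h
  have h2 := congrArg sides h1
  rw [sides_z_pow_mul, sides_gauss_mul, sides_gauss_mul, neg_sq] at h2
  refine Multiset.map_injective (mul_right_injective₀ fun h0 => relNorm_ne_zero hq0 ?_) h2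
  rw [relNorm_gauss, h0, Int.cast_zero]

/-- Up to conjugation and units, `x` and `y` differ by a Gaussian number of modulus `1`. -/
def GaussRelated (x y : 𝓞 K) : Prop :=
  ∃ (φ : 𝓞 K ≃+* 𝓞 K) (u : (𝓞 K)ˣ) (a b : 𝓞 K), swap a = a ∧ swap b = b ∧ a ≠ 0 ∧
    relNorm a = relNorm b ∧ x * a = φ y * u * b

lemma GaussRelated.of_ringEquiv {x y : 𝓞 K} (ψ : 𝓞 K ≃+* 𝓞 K) (h : GaussRelated x (ψ y)) :
    GaussRelated x y := by
  obtain ⟨φ, u, a, b, h⟩ := h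
  exact ⟨ψ.trans φ, u, a, b, h⟩

lemma GaussRelated.of_z_mul {x y : 𝓞 K} (h : GaussRelated x (z * y)) : GaussRelated x y := by
  obtain ⟨φ, u, a, b, h1, h2, h3, h4, h5⟩ := h
  have hz : IsUnit (φ z) := (z_isPrimitiveRoot.isUnit (by norm_num)).map φ
  refine ⟨φ, hz.unit * u, a, b, h1, h2, h3, h4, ?_⟩
  rw [h5, map_mul, Units.val_mul, IsUnit.unit_spec]
  ring

lemma gaussRelated_of_gaussMul_eq {T T' : Triangle} {a b c d : ℤ} (h0 : a ^ 2 + b ^ 2 ≠ 0)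
    (h : a ^ 2 + b ^ 2 = c ^ 2 + d ^ 2) (hT : gaussMul a b T = gaussMul c d T') :
    GaussRelated T.toInt T'.toInt := by
  refine ⟨RingEquiv.refl _, 1, gauss a b, gauss c d, gauss_swap _ _, gauss_swap _ _, ?_, ?_, ?_⟩
  · intro h1
    have := relNorm_gauss a b
    rw [h1, relNorm, zero_mul] at this
    exact h0 (Int.cast_injective (α := 𝓞 K) (by simpa using this.symm))
  · rw [relNorm_gauss, relNorm_gauss, h]
  · rw [mul_comm, ← toInt_gaussMul, hT, toInt_gaussMul]
    simp [mul_comm]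

/-- The product of v with the complex conjugate of w has the inner product as real part and −A as
imaginary part. Multiplying each triangle by the conjugate of its own w thus gives the same result.
If w = 0, the conjugate of v serves instead. -/
lemma gaussRelated_of_signedArea_eq {T T' : Triangle} (hT : T.toInt ≠ 0)
    (h1 : T.m ^ 2 + T.n ^ 2 = T'.m ^ 2 + T'.n ^ 2) (h2 : T.k ^ 2 + T.l ^ 2 = T'.k ^ 2 + T'.l ^ 2)
    (h3 : T.m * T.k + T.n * T.l = T'.m * T'.k + T'.n * T'.l)
    (h4 : T.signedArea = T'.signedArea) : GaussRelated T.toInt T'.toInt := by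
  unfold signedArea at h4
  by_cases h0 : T.k ^ 2 + T.l ^ 2 = 0
  · refine gaussRelated_of_gaussMul_eq (a := T.m) (b := -T.n) (c := T'.m) (d := -T'.n) ?_ ?_ ?_
    · intro h
      refine hT ?_
      have e : T = ⟨0, 0, 0, 0⟩ := eq_zero_of_halfSum T (by
        have := two_mul_halfSum T
        have : T.m = 0 ∧ T.n = 0 ∧ T.k = 0 ∧ T.l = 0 := by
          refine ⟨?_, ?_, ?_, ?_⟩ <;> nlinarith
        simp [halfSum, this])
      rw [e]; simp [toInt]
    · linear_combination h1
    · simp only [gaussMul, Triangle.mk.injEq]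
      refine ⟨?_, ?_, ?_, ?_⟩
      · linear_combination h1
      · ring
      · linear_combination h3
      · linear_combination h4
  · refine gaussRelated_of_gaussMul_eq (a := T.k) (b := -T.l) (c := T'.k) (d := -T'.l) ?_ ?_ ?_
    · rwa [neg_sq]
    · linear_combination h2
    · simp only [gaussMul, Triangle.mk.injEq]
      refine ⟨?_, ?_, ?_, ?_⟩
      · linear_combination h3
      · linear_combination -h4
      · linear_combination h2
      · ring

lemma gaussRelated_of_sides_eq {T T' : Triangle} (hT : T.toInt ≠ 0)
    (h1 : T.m ^ 2 + T.n ^ 2 = T'.m ^ 2 + T'.n ^ 2) (h2 : T.k ^ 2 + T.l ^ 2 = T'.k ^ 2 + T'.l ^ 2)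
    (h3 : (T.m - T.k) ^ 2 + (T.n - T.l) ^ 2 = (T'.m - T'.k) ^ 2 + (T'.n - T'.l) ^ 2) :
    GaussRelated T.toInt T'.toInt := by
  have h4 : T.m * T.k + T.n * T.l = T'.m * T'.k + T'.n * T'.l := by lia
  -- Lagrange's identity: A² = |v|²|w|² − (v·w)².
  have h5 : T.signedArea ^ 2 = T'.signedArea ^ 2 := by
    unfold signedArea
    linear_combination (T.k ^ 2 + T.l ^ 2) * h1 + (T'.m ^ 2 + T'.n ^ 2) * h2 -
      (T.m * T.k + T.n * T.l + (T'.m * T'.k + T'.n * T'.l)) * h4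
  rcases sq_eq_sq_iff_eq_or_eq_neg.mp h5 with h | h
  · exact gaussRelated_of_signedArea_eq hT h1 h2 h4 h
  -- This automorphism is the reflection (v, w) ↦ (v̄, w̄), which reverses the sign of the area.
  · apply GaussRelated.of_ringEquiv (conj.trans swap)
    rw [RingEquiv.trans_apply, ← toInt_tri (conj T'.toInt), tri_conj, ← toInt_tri (swap _), tri_swap]
    apply gaussRelated_of_signedArea_eq hT
    · simpa using h1
    · simpa using h2
    · simpa using h4
    · rw [h]; simp only [signedArea]; ring

lemma multiset_triple_eq {α : Type*} {a b c a' b' c' : α}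
    (h : ({a, b, c} : Multiset α) = {a', b', c'}) :
    (a = a' ∧ b = b' ∧ c = c') ∨ (a = a' ∧ b = c' ∧ c = b') ∨ (a = b' ∧ b = a' ∧ c = c') ∨
    (a = b' ∧ b = c' ∧ c = a') ∨ (a = c' ∧ b = a' ∧ c = b') ∨ (a = c' ∧ b = b' ∧ c = a') := by
  classical
  have pair : ∀ {b c b' c' : α}, ({b, c} : Multiset α) = {b', c'} →
      (b = b' ∧ c = c') ∨ (b = c' ∧ c = b') := by
    intro b c b' c' h
    have hb : b ∈ ({b', c'} : Multiset α) := by rw [← h]; simp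
    simp only [Multiset.insert_eq_cons, Multiset.mem_cons, Multiset.mem_singleton] at hb
    rcases hb with rfl | rfl
    · left; simpa using h
    · right; rw [Multiset.pair_comm b'] at h; simpa using h
  have ha : a ∈ ({a', b', c'} : Multiset α) := by rw [← h]; simp
  simp only [Multiset.insert_eq_cons, Multiset.mem_cons, Multiset.mem_singleton] at ha h
  rcases ha with rfl | rfl | rfl
  · have := pair ((Multiset.cons_inj_right _).mp h)
    tauto
  · have := pair ((Multiset.cons_inj_right _).mp (h.trans (Multiset.cons_swap _ _ _)))
    tauto
  · rw [← Multiset.insert_eq_cons b', Multiset.pair_comm b', Multiset.insert_eq_cons] at h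
    have := pair ((Multiset.cons_inj_right _).mp (h.trans (Multiset.cons_swap _ _ _)))
    tauto

/-- Triangles with the same sides are related by a Gaussian number of modulus `1`. -/
lemma gaussRelated_of_congr {x y : 𝓞 K} (hx : x ≠ 0) (h : (tri x).Congr (tri y)) :
    GaussRelated x y := by
  obtain ⟨T, rfl⟩ := toInt_surjective x
  obtain ⟨T', rfl⟩ := toInt_surjective y
  simp only [Congr, tri_toInt, sqSides] at h
  have hz : ∀ y, GaussRelated T.toInt (tri (z * y)).toInt → GaussRelated T.toInt y := fun y hy =>
    GaussRelated.of_z_mul (by simpa using hy)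
  have hs : ∀ y, GaussRelated T.toInt (tri (swap y)).toInt → GaussRelated T.toInt y := fun y hy =>
    GaussRelated.of_ringEquiv swap (by simpa using hy)
  -- Multiplication by z cycles the three sides and `swap` exchanges two of them, so together they
  -- realise all six matchings.
  rcases multiset_triple_eq h with ⟨h1, h2, h3⟩ | ⟨h1, h2, h3⟩ | ⟨h1, h2, h3⟩ | ⟨h1, h2, h3⟩ |
    ⟨h1, h2, h3⟩ | ⟨h1, h2, h3⟩
  · exact gaussRelated_of_sides_eq hx h3 h2 h1
  · apply hs
    rw [tri_swap]
    apply gaussRelated_of_sides_eq hx <;> dsimp only <;> lia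
  · apply hs
    apply hz
    rw [tri_swap, tri_z_mul]
    apply gaussRelated_of_sides_eq hx <;> dsimp only <;> ring_nf at * <;> lia
  · apply hz
    apply hz
    rw [tri_z_mul, tri_z_mul]
    apply gaussRelated_of_sides_eq hx <;> dsimp only <;> ring_nf at * <;> lia
  · apply hz
    rw [tri_z_mul]
    apply gaussRelated_of_sides_eq hx <;> dsimp only <;> ring_nf at * <;> lia
  · apply hz
    apply hs
    rw [tri_z_mul, tri_swap]
    apply gaussRelated_of_sides_eq hx <;> dsimp only <;> ring_nf at * <;> lia

open Triangle

/-! ### Cosets, indexations and families -/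

lemma conj_comm (φ : 𝓞 K ≃+* 𝓞 K) (x : 𝓞 K) : conj (φ x) = φ (conj x) := by
  rcases ringEquiv_cases φ with h | h | h | h <;> simp only [h, swap_conj]

lemma relNorm_map (φ : 𝓞 K ≃+* 𝓞 K) (x : 𝓞 K) : relNorm (φ x) = φ (relNorm x) := by
  simp only [relNorm, conj_comm, map_mul]

lemma self_mem_coset (α : 𝓞 K) : α ∈ coset α := ⟨RingEquiv.refl _, 1, by simp⟩

lemma coset_trans {α β γ : 𝓞 K} (h1 : β ∈ coset α) (h2 : γ ∈ coset β) : γ ∈ coset α := by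
  obtain ⟨φ, u, rfl⟩ := h1
  obtain ⟨ψ, v, rfl⟩ := h2
  refine ⟨φ.trans ψ, Units.map ψ.toMonoidHom u * v, ?_⟩
  simp [mul_assoc]

lemma coset_symm {α β : 𝓞 K} (h : β ∈ coset α) : α ∈ coset β := by
  obtain ⟨φ, u, rfl⟩ := h
  refine ⟨φ.symm, Units.map φ.symm.toMonoidHom u⁻¹, ?_⟩
  have : φ.symm (u : 𝓞 K) * φ.symm (↑u⁻¹ : 𝓞 K) = 1 := by rw [← map_mul]; simp
  simp [mul_assoc, this]

lemma coset_eq_of_mem {α β : 𝓞 K} (h : β ∈ coset α) : coset β = coset α :=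
  Set.Subset.antisymm (fun _ hγ => coset_trans h hγ) fun _ hγ => coset_trans (coset_symm h) hγ

lemma mul_unit_mem_coset {α β : 𝓞 K} (h : β ∈ coset α) (u : (𝓞 K)ˣ) : β * u ∈ coset α :=
  coset_trans h ⟨RingEquiv.refl _, u, rfl⟩

lemma map_mem_coset {α β : 𝓞 K} (h : β ∈ coset α) (φ : 𝓞 K ≃+* 𝓞 K) : φ β ∈ coset α :=
  coset_trans h ⟨φ, 1, by simp⟩

lemma ne_zero_of_mem_coset {α β : 𝓞 K} (hα : α ≠ 0) (h : β ∈ coset α) : β ≠ 0 := by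
  obtain ⟨φ, u, rfl⟩ := h
  exact mul_ne_zero ((map_ne_zero_iff _ φ.injective).mpr hα) u.ne_zero

lemma coset_eq_of_mem_cosets {C : Set (𝓞 K)} (hC : C ∈ cosets) {α : 𝓞 K} (hα : α ∈ C) :
    α ≠ 0 ∧ C = coset α := by
  obtain ⟨β, hβ, rfl⟩ := hC
  exact ⟨ne_zero_of_mem_coset hβ hα, (coset_eq_of_mem hα).symm⟩

lemma coe_onePlusZ_zpow (j : ℤ) : (((onePlusZ ^ j : (𝓞 K)ˣ) : 𝓞 K) : K) = (1 + ζ) ^ j := by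
  have h : ((Units.map (algebraMap (𝓞 K) K).toMonoidHom onePlusZ : Kˣ) : K) = 1 + ζ := by
    simp [onePlusZ, coe_z]
  have h2 := congrArg Units.val (map_zpow (Units.map (algebraMap (𝓞 K) K).toMonoidHom) onePlusZ j)
  rw [Units.val_zpow_eq_zpow_val, h] at h2
  rw [← h2]
  rfl

lemma isIndexation_iff (C : Set (𝓞 K)) (T : ℤ → Triangle) :
    IsIndexation C T ↔ ∃ α ∈ C, ∀ j : ℤ, T j = tri (α * (onePlusZ ^ j : (𝓞 K)ˣ)) := by
  have key : ∀ (α : 𝓞 K) (j : ℤ), (α : K) * (1 + ζ) ^ j =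
      ((α * (onePlusZ ^ j : (𝓞 K)ˣ) : 𝓞 K) : K) := fun α j => by
    rw [← coe_onePlusZ_zpow]
    exact (map_mul (algebraMap (𝓞 K) K) _ _).symm
  unfold IsIndexation
  simp only [key]
  refine exists_congr fun α => and_congr_right fun _ => forall_congr' fun j =>
    ⟨eq_tri_of_toField, fun h => ?_⟩
  rw [h, ← coe_toInt, toInt_tri]

/-- The data of an equal-area indexation: representatives with a common relative norm. -/
lemma IsEqualAreaIndexation.exists_relNorm {F : Set (Set (𝓞 K))} {T : Set (𝓞 K) → ℤ → Triangle}
    (hF : F ⊆ cosets) (h : IsEqualAreaIndexation F T) :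
    ∃ a : Set (𝓞 K) → 𝓞 K, (∀ C ∈ F, a C ∈ C ∧ ∀ j : ℤ,
      T C j = tri (a C * (onePlusZ ^ j : (𝓞 K)ˣ))) ∧
      ∀ C ∈ F, ∀ C' ∈ F, relNorm (a C) = relNorm (a C') := by
  have h1 : ∀ C, ∃ α : 𝓞 K, C ∈ F → α ∈ C ∧ ∀ j : ℤ,
      T C j = tri (α * (onePlusZ ^ j : (𝓞 K)ˣ)) := fun C => by
    by_cases hC : C ∈ F
    · obtain ⟨α, hα⟩ := (isIndexation_iff _ _).mp (h.1 C hC)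
      exact ⟨α, fun _ => hα⟩
    -- Outside `F` the value is irrelevant; 0 only makes the choice function total.
    · exact ⟨0, fun hC' => absurd hC' hC⟩
  choose a ha using h1
  refine ⟨a, ha, fun C hC C' hC' => ?_⟩
  apply relNorm_eq_of_area_eq (coset_eq_of_mem_cosets (hF hC) (ha C hC).1).1
    (coset_eq_of_mem_cosets (hF hC') (ha C' hC').1).1
  intro n
  have := h.2 C hC C' hC' n
  rw [(ha C hC).2, (ha C' hC').2] at this
  simpa using this

lemma equalArea_of_relNorm {F : Set (Set (𝓞 K))} (hF : F ⊆ cosets) (ν : 𝓞 K)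
    (h : ∀ C ∈ F, ∃ α ∈ C, relNorm α = ν) : EqualArea F := by
  refine ⟨hF, ?_⟩
  have h1 : ∀ C, ∃ α : 𝓞 K, C ∈ F → α ∈ C ∧ relNorm α = ν := fun C => by
    by_cases hC : C ∈ F
    · obtain ⟨α, hα⟩ := h C hC
      exact ⟨α, fun _ => hα⟩
    · exact ⟨0, fun hC' => absurd hC' hC⟩
  choose a ha using h1
  refine ⟨fun C j => tri (a C * (onePlusZ ^ j : (𝓞 K)ˣ)), fun C hC => ?_, fun C hC C' hC' j => ?_⟩
  · exact (isIndexation_iff _ _).mpr ⟨a C, (ha C hC).1, fun j => rfl⟩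
  · have : relNorm (a C * (onePlusZ ^ j : (𝓞 K)ˣ)) = relNorm (a C' * (onePlusZ ^ j : (𝓞 K)ˣ)) := by
      rw [relNorm_mul, relNorm_mul, (ha C hC).2, (ha C' hC').2]
    rw [area_eq_abs, area_eq_abs, ((relNorm_eq_iff _ _).mp this).2]

/-- The cosets that contain an element with the same relative norm as some element of `coset α`. -/
def familyOf (α : 𝓞 K) : Set (Set (𝓞 K)) :=
  {C | C ∈ cosets ∧ ∃ β ∈ C, relNorm β = relNorm α}

/-- Apply to β the automorphism and the unit that carry α to γ. This makes the family independent of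
the chosen representative. -/
lemma exists_relNorm_eq {α β γ : 𝓞 K} (h : relNorm β = relNorm α) (hγ : γ ∈ coset α) :
    ∃ δ ∈ coset β, relNorm δ = relNorm γ := by
  obtain ⟨φ, u, rfl⟩ := hγ
  exact ⟨φ β * u, ⟨φ, u, rfl⟩, by simp only [relNorm_mul, relNorm_map, h]⟩

lemma coset_mem_familyOf {α : 𝓞 K} (hα : α ≠ 0) : coset α ∈ familyOf α :=
  ⟨⟨α, hα, rfl⟩, α, self_mem_coset α, rfl⟩

lemma equalArea_familyOf (α : 𝓞 K) : EqualArea (familyOf α) :=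
  equalArea_of_relNorm (fun _ h => h.1) (relNorm α) fun _ h => h.2

lemma subset_familyOf {F : Set (Set (𝓞 K))} (hF : EqualArea F) {α : 𝓞 K}
    (hα : coset α ∈ F) : F ⊆ familyOf α := by
  obtain ⟨hF', T, hT⟩ := hF
  obtain ⟨a, ha, hν⟩ := hT.exists_relNorm hF'
  intro C hC
  refine ⟨hF' hC, ?_⟩
  have h1 := (coset_eq_of_mem_cosets (hF' hC) (ha C hC).1).2
  obtain ⟨δ, hδ, e⟩ := exists_relNorm_eq (hν C hC _ hα) (coset_symm (ha _ hα).1)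
  exact ⟨δ, by rwa [h1], e⟩

lemma isFamily_familyOf {α : 𝓞 K} (hα : α ≠ 0) : IsFamily (familyOf α) :=
  ⟨equalArea_familyOf α, fun _ hG hle => subset_familyOf hG (hle (coset_mem_familyOf hα))⟩

lemma IsFamily.nonempty {F : Set (Set (𝓞 K))} (hF : IsFamily F) : F.Nonempty := by
  by_contra h
  rw [Set.not_nonempty_iff_eq_empty] at h
  have := hF.2 (equalArea_familyOf 1) (by rw [h]; exact Set.empty_subset _)
    (coset_mem_familyOf one_ne_zero)
  rw [h] at this
  exact this

lemma IsFamily.eq_familyOf {F : Set (Set (𝓞 K))} (hF : IsFamily F) {α : 𝓞 K}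
    (hα : coset α ∈ F) : F = familyOf α :=
  hF.eq_of_le (equalArea_familyOf α) (subset_familyOf hF.1 hα)

lemma IsFamily.eq_of_mem {F F' : Set (Set (𝓞 K))} (hF : IsFamily F) (hF' : IsFamily F')
    {C : Set (𝓞 K)} (h : C ∈ F) (h' : C ∈ F') : F = F' := by
  obtain ⟨α, -, rfl⟩ := hF.1.1 h
  rw [hF.eq_familyOf h, hF'.eq_familyOf h']

/-- An equal-area property stronger than `EqualArea` that holds for a family is maximal there. -/
lemma IsFamily.maximal {F : Set (Set (𝓞 K))} (hF : IsFamily F) {P : Set (Set (𝓞 K)) → Prop}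
    (hP : ∀ G, P G → EqualArea G) (h : P F) : Maximal P F :=
  ⟨h, fun _ hG hle => hF.2 (hP _ hG) hle⟩

/-- The hypothesis rules out congruences between distinct cosets whatever the labels, so every
equal-area indexation witnesses B1 and none can witness B2. -/
lemma IsFamily.isClassB1 {F : Set (Set (𝓞 K))} (hF : IsFamily F) (hn : F.Nontrivial)
    (h : ∀ C ∈ F, ∀ C' ∈ F, ∀ α ∈ C, ∀ β ∈ C', (tri α).Congr (tri β) → C = C') :
    IsClassB1 F ∧ ¬ IsClassB2 F := by
  have hmem : ∀ C ∈ F, ∀ T j, IsIndexation C T → ∃ γ ∈ C, T j = tri γ := by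
    intro C hC T j hT
    obtain ⟨α, hα, h⟩ := (isIndexation_iff _ _).mp hT
    refine ⟨_, ?_, h j⟩
    rw [(coset_eq_of_mem_cosets (hF.1.1 hC) hα).2]
    exact mul_unit_mem_coset (self_mem_coset _) _
  have key : ∀ T, IsEqualAreaIndexation F T → ∀ C ∈ F, ∀ C' ∈ F, C ≠ C' → ∀ j : ℤ,
      ¬ (T C j).Congr (T C' j) := by
    intro T hT C hC C' hC' hne j hc
    obtain ⟨γ, hγ, e⟩ := hmem C hC _ j (hT.1 C hC)
    obtain ⟨γ', hγ', e'⟩ := hmem C' hC' _ j (hT.1 C' hC')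
    rw [e, e'] at hc
    exact hne (h C hC C' hC' γ hγ γ' hγ' hc)
  obtain ⟨hF1, T, hT⟩ := hF.1
  refine ⟨hF.maximal (fun G hG => ⟨hG.1, ?_⟩) ⟨hF1, hn, T, hT, key T hT⟩, ?_⟩
  · obtain ⟨-, -, T, hT, -⟩ := hG
    exact ⟨T, hT⟩
  · rintro ⟨⟨-, T, hT, h2⟩, -⟩
    obtain ⟨⟨C, hC, C', hC', hne, hc⟩, -⟩ := h2 0
    exact key T hT C hC C' hC' hne 0 hc

/-- In any equal-area indexation the representatives of `A` and `B` have equal relative norms at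
every label, so their triangles are congruent; those of `A` and `D` never are. This yields B2 and
excludes B1 for all indexations at once. -/
lemma IsFamily.isClassB2 {F : Set (Set (𝓞 K))} (hF : IsFamily F) {A B D : Set (𝓞 K)}
    (hA : A ∈ F) (hB : B ∈ F) (hD : D ∈ F) (hAB : A ≠ B)
    (h : ∀ α ∈ A, ∀ β ∈ B, relNorm α = relNorm β → (tri α).Congr (tri β))
    (h' : ∀ α ∈ A, ∀ β ∈ D, ¬ (tri α).Congr (tri β)) :
    IsClassB2 F ∧ ¬ IsClassB1 F := by
  have hmem : ∀ C ∈ F, ∀ α ∈ C, ∀ j : ℤ, α * (onePlusZ ^ j : (𝓞 K)ˣ) ∈ C := by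
    intro C hC α hα j
    rw [(coset_eq_of_mem_cosets (hF.1.1 hC) hα).2]
    exact mul_unit_mem_coset (self_mem_coset _) _
  have key : ∀ T, IsEqualAreaIndexation F T → ∀ j : ℤ,
      (T A j).Congr (T B j) ∧ ¬ (T A j).Congr (T D j) := by
    intro T hT j
    obtain ⟨a, ha, hν⟩ := hT.exists_relNorm hF.1.1
    rw [(ha A hA).2, (ha B hB).2, (ha D hD).2]
    refine ⟨h _ (hmem _ hA _ (ha A hA).1 j) _ (hmem _ hB _ (ha B hB).1 j) ?_,
      h' _ (hmem _ hA _ (ha A hA).1 j) _ (hmem _ hD _ (ha D hD).1 j)⟩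
    rw [relNorm_mul, relNorm_mul, hν A hA B hB]
  obtain ⟨hF1, T, hT⟩ := hF.1
  refine ⟨hF.maximal (fun G hG => ⟨hG.1, ?_⟩) ⟨hF1, T, hT, fun j =>
    ⟨⟨A, hA, B, hB, hAB, (key T hT j).1⟩, ⟨A, hA, D, hD, (key T hT j).2⟩⟩⟩, ?_⟩
  · obtain ⟨-, T, hT, -⟩ := hG
    exact ⟨T, hT⟩
  · rintro ⟨⟨-, -, T, hT, h2⟩, -⟩
    exact h2 A hA B hB hAB 0 (key T hT 0).1

lemma norm_eq_of_relNorm_eq {α β : 𝓞 K} (h : relNorm α = relNorm β) :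
    Algebra.norm ℤ α = Algebra.norm ℤ β := by
  apply Int.cast_injective (α := 𝓞 K)
  rw [coe_norm, coe_norm, h]

lemma norm_nonneg (x : 𝓞 K) : 0 ≤ Algebra.norm ℤ x := by
  have h : Algebra.norm ℤ x = (tri x).halfSum ^ 2 - 3 * (tri x).signedArea ^ 2 := by
    apply Int.cast_injective (α := 𝓞 K)
    rw [coe_norm, relNorm_eq]
    simp only [map_sub, map_mul, map_intCast, swap_sqrtThree]
    push_cast
    linear_combination -((tri x).signedArea : 𝓞 K) ^ 2 * sqrtThree_sq
  rw [h]
  exact norm_form_nonneg _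

lemma norm_unit (u : (𝓞 K)ˣ) : Algebra.norm ℤ (u : 𝓞 K) = 1 := by
  have h := Int.isUnit_iff.mp (u.isUnit.map (Algebra.norm ℤ))
  have := norm_nonneg (u : 𝓞 K)
  lia

lemma norm_map (φ : 𝓞 K ≃+* 𝓞 K) (x : 𝓞 K) : Algebra.norm ℤ (φ x) = Algebra.norm ℤ x := by
  apply Int.cast_injective (α := 𝓞 K)
  rw [coe_norm, relNorm_map]
  rcases ringEquiv_cases φ with h | h | h | h <;> rw [coe_norm, h]
  · simp only [relNorm, map_mul, swap_conj, conj_conj]; ring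
  · rw [swap_swap]; ring
  · simp only [relNorm, map_mul, swap_conj, conj_conj, swap_swap]; ring

lemma norm_eq_of_mem_coset {α β : 𝓞 K} (h : β ∈ coset α) :
    Algebra.norm ℤ β = Algebra.norm ℤ α := by
  obtain ⟨φ, u, rfl⟩ := h
  rw [map_mul, norm_unit, norm_map, mul_one]

lemma familyOf_subset_solutionCosets {α : 𝓞 K} {r : ℤ} (h : Algebra.norm ℤ α = r) :
    familyOf α ⊆ solutionCosets r := by
  rintro C ⟨hC, β, hβ, e⟩
  exact ⟨β, (norm_eq_of_relNorm_eq e).trans h, (coset_eq_of_mem_cosets hC hβ).2⟩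

/-- The families in a set of solution cosets are the families of its elements. -/
lemma solutionFamilies_eq {r : ℤ} (hr : r ≠ 0) :
    solutionFamilies r = {F | ∃ α : 𝓞 K, Algebra.norm ℤ α = r ∧ F = familyOf α} := by
  have ne : ∀ {α : 𝓞 K}, Algebra.norm ℤ α = r → α ≠ 0 := fun h h0 => hr (by rw [← h, h0]; simp)
  ext F
  constructor
  · rintro ⟨hF, hs⟩
    obtain ⟨C, hC⟩ := hF.nonempty
    obtain ⟨α, hα, rfl⟩ := hs hC
    exact ⟨α, hα, hF.eq_familyOf hC⟩
  · rintro ⟨α, hα, rfl⟩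
    exact ⟨isFamily_familyOf (ne hα), familyOf_subset_solutionCosets hα⟩

lemma familyOf_eq_iff {α β : 𝓞 K} (hα : α ≠ 0) (hβ : β ≠ 0) :
    familyOf α = familyOf β ↔ ∃ γ ∈ coset β, relNorm γ = relNorm α := by
  constructor
  · intro h
    have : coset β ∈ familyOf α := by rw [h]; exact coset_mem_familyOf hβ
    exact this.2
  · intro h
    exact (isFamily_familyOf hα).eq_of_mem (isFamily_familyOf hβ)
      (C := coset β) ⟨⟨β, hβ, rfl⟩, h⟩ (coset_mem_familyOf hβ)

open Triangle

/-! ### Unique factorisation and the splitting of p -/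

instance isPrincipalIdealRing : IsPrincipalIdealRing (𝓞 K) := by
  apply _root_.RingOfIntegers.isPrincipalIdealRing_of_abs_discr_lt
  rw [IsCyclotomicExtension.Rat.discr 12 K, IsCyclotomicExtension.finrank (n := 12) K
    (Polynomial.cyclotomic.irreducible_rat (by simp)),
    IsCyclotomicExtension.Rat.nrComplexPlaces_eq_totient_div_two 12]
  have h1 : Nat.totient 12 = 4 := by decide
  have h2 : Nat.primeFactors 12 = {2, 3} := by decide +kernel
  rw [h1, h2, Finset.prod_pair (by norm_num)]
  norm_num [Nat.factorial]
  have h3 : 3 / 4 < Real.pi / 4 := by linarith [Real.pi_gt_three]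
  -- With 3 in place of the circle constant, Minkowski's bound equals the discriminant 144; the
  -- strict inequality is exactly what π > 3 adds.
  calc (144 : ℝ) = (2 * (3 / 4) ^ 2 * (32 / 3)) ^ 2 := by norm_num
    _ < _ := by gcongr

/-- A prime of `ℤ[ζ]` that divides none of its other conjugates. -/
structure IsSplitPrime (π : 𝓞 K) : Prop where
  prime : Prime π
  not_dvd_conj : ¬ π ∣ conj π
  not_dvd_swap : ¬ π ∣ swap π
  not_dvd_conj_swap : ¬ π ∣ conj (swap π)

lemma exists_orderOf_eq_twelve {p : ℕ} [Fact p.Prime] (hp : p % 12 = 1) :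
    ∃ x : ZMod p, IsPrimitiveRoot x 12 := by
  obtain ⟨g, hg⟩ := IsCyclic.exists_ofOrder_eq_natCard (α := (ZMod p)ˣ)
  rw [Nat.card_eq_fintype_card, ZMod.card_units] at hg
  have h1 : IsPrimitiveRoot g (p - 1) := hg ▸ IsPrimitiveRoot.orderOf g
  have hp1 := (Fact.out : p.Prime).two_le
  have h2 := h1.pow (n := p - 1) (a := (p - 1) / 12) (b := 12) (by lia) (by lia)
  exact ⟨((g ^ ((p - 1) / 12) : (ZMod p)ˣ) : ZMod p), IsPrimitiveRoot.coe_units_iff.mpr h2⟩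

lemma exists_ringHom_zmod {p : ℕ} [Fact p.Prime] (hp : p % 12 = 1) :
    ∃ f : 𝓞 K →+* ZMod p, IsPrimitiveRoot (f z) 12 := by
  obtain ⟨x, hx⟩ := exists_orderOf_eq_twelve hp
  let B := (IsCyclotomicExtension.zeta_spec 12 ℚ K).integralPowerBasis
  have hg : B.gen = z := IsPrimitiveRoot.integralPowerBasis_gen _
  have hm : minpoly ℤ B.gen = Polynomial.cyclotomic 12 ℤ := by
    rw [hg, ← NumberField.RingOfIntegers.minpoly_coe]
    exact (Polynomial.cyclotomic_eq_minpoly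
      (IsCyclotomicExtension.zeta_spec 12 ℚ K) (by norm_num)).symm
  have h0 : Polynomial.aeval x (minpoly ℤ B.gen) = 0 := by
    rw [hm, Polynomial.aeval_def, Polynomial.eval₂_eq_eval_map, Polynomial.map_cyclotomic]
    exact hx.isRoot_cyclotomic (by norm_num)
  refine ⟨(B.lift x h0).toRingHom, ?_⟩
  have : (B.lift x h0) z = x := by rw [← hg]; exact B.lift_gen x h0
  simpa [this] using hx

lemma exists_isSplitPrime {p : ℕ} (hp : p.Prime) (hp12 : p % 12 = 1) :
    ∃ π : 𝓞 K, IsSplitPrime π ∧ Algebra.norm ℤ π = p := by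
  have : Fact p.Prime := ⟨hp⟩
  obtain ⟨f, hf⟩ := exists_ringHom_zmod hp12
  obtain ⟨π, hπ⟩ := (IsPrincipalIdealRing.principal (RingHom.ker f)).principal
  rw [← Ideal.span] at hπ
  have hmem : ∀ x, f x = 0 ↔ π ∣ x := fun x => by
    rw [← RingHom.mem_ker, hπ, Ideal.mem_span_singleton]
  have hN : Ideal.absNorm (Ideal.span {π}) = p := by
    rw [← hπ, Ideal.absNorm_apply, Submodule.cardQuot_apply]
    rw [Nat.card_congr (RingHom.quotientKerEquivOfSurjective
      (ZMod.ringHom_surjective f)).toEquiv, Nat.card_zmod]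
  rw [Ideal.absNorm_span_singleton] at hN
  have hnorm : Algebra.norm ℤ π = p := by
    have := norm_nonneg π
    lia
  have hπ0 : π ≠ 0 := by
    rintro rfl
    exact hp.ne_zero (by simpa using hN.symm)
  have hprime : Prime π := by
    rw [← Ideal.span_singleton_prime hπ0, ← hπ]
    exact RingHom.ker_isPrime f
  -- Modulo π, z is congruent to an integer n. If π divided φ(π), it would also divide φ(z) − n, so
  -- f(z)^(k+1) = f(z), against the order 12 of f(z).
  have key : ∀ (φ : 𝓞 K ≃+* 𝓞 K) (k : ℕ), φ z = z ^ (k + 1) → ¬ 12 ∣ k → ¬ π ∣ φ π := by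
    intro φ k hk hk' hd
    obtain ⟨n, hn⟩ := ZMod.intCast_surjective (f z)
    have h1 : π ∣ z - n := by rw [← hmem]; simp [hn]
    have h2 : π ∣ φ (z - n) := hd.trans (map_dvd φ h1)
    rw [← hmem, map_sub, map_sub, map_intCast, map_intCast, hn, hk, map_pow, pow_succ] at h2
    have h3 : f z ≠ 0 := hf.ne_zero (by norm_num)
    have h4 : f z ^ k = 1 := by
      apply mul_right_cancel₀ h3
      rw [one_mul]
      exact sub_eq_zero.mp h2
    exact hk' ((hf.pow_eq_one_iff_dvd k).mp h4)
  refine ⟨π, ⟨hprime, key conj 10 conj_z (by norm_num), key swap 4 swap_z (by norm_num),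
    key (swap.trans conj) 6 ?_ (by norm_num)⟩, hnorm⟩
  rw [RingEquiv.trans_apply, swap_z, map_pow, conj_z, ← pow_mul]
  calc z ^ (11 * 5) = (z ^ 12) ^ 4 * z ^ 7 := by ring
    _ = z ^ 7 := by rw [z_pow_twelve]; ring

/-! ### Exponents of the conjugate primes: solution cosets and families -/

/-- The exponents of the four conjugate primes. -/
abbrev Exps : Type := (ℕ × ℕ) × (ℕ × ℕ)

namespace Exps

/-- The effect of complex conjugation on the exponents. -/
def conj (e : Exps) : Exps := ((e.1.2, e.1.1), (e.2.2, e.2.1))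

/-- The effect of `swap` on the exponents. -/
def swap (e : Exps) : Exps := (e.2, e.1)

end Exps

/-- The product of powers of the conjugates of `π`. -/
def mono (π : 𝓞 K) (e : Exps) : 𝓞 K :=
  π ^ e.1.1 * conj π ^ e.1.2 * (swap π ^ e.2.1 * conj (swap π) ^ e.2.2)

lemma conj_mono (π : 𝓞 K) (e : Exps) : conj (mono π e) = mono π e.conj := by
  simp only [mono, Exps.conj, map_mul, map_pow, conj_conj]; ring

lemma swap_mono (π : 𝓞 K) (e : Exps) : swap (mono π e) = mono π e.swap := by
  simp only [mono, Exps.swap, map_mul, map_pow, swap_swap, swap_conj]; ring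

lemma relNorm_pow (x : 𝓞 K) (n : ℕ) : relNorm (x ^ n) = relNorm x ^ n := by
  simp only [relNorm, map_pow, mul_pow]

lemma relNorm_mono (π : 𝓞 K) (e : Exps) : relNorm (mono π e) =
    relNorm π ^ (e.1.1 + e.1.2) * relNorm (swap π) ^ (e.2.1 + e.2.2) := by
  simp only [mono, relNorm_mul, relNorm_pow, relNorm_conj, pow_add]

lemma norm_mono (π : 𝓞 K) (e : Exps) :
    Algebra.norm ℤ (mono π e) = Algebra.norm ℤ π ^ (e.1.1 + e.1.2 + (e.2.1 + e.2.2)) := by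
  simp only [mono, map_mul, map_pow, norm_map, pow_add]

namespace IsSplitPrime

variable {π : 𝓞 K}

lemma ne_zero (h : IsSplitPrime π) : π ≠ 0 := h.prime.ne_zero

lemma finite (h : IsSplitPrime π) {x : 𝓞 K} (hx : x ≠ 0) : FiniteMultiplicity π x :=
  FiniteMultiplicity.of_prime_left h.prime hx

lemma mul (h : IsSplitPrime π) {x y : 𝓞 K} (hx : x ≠ 0) (hy : y ≠ 0) :
    multiplicity π (x * y) = multiplicity π x + multiplicity π y :=
  multiplicity_mul h.prime (h.finite (mul_ne_zero hx hy))

lemma unit (h : IsSplitPrime π) (u : (𝓞 K)ˣ) : multiplicity π (u : 𝓞 K) = 0 :=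
  multiplicity_of_unit_right h.prime.not_isUnit u

lemma map_ne_zero {x : 𝓞 K} (hx : x ≠ 0) (φ : 𝓞 K ≃+* 𝓞 K) : φ x ≠ 0 :=
  (map_ne_zero_iff _ φ.injective).mpr hx

lemma mono_ne_zero (h : IsSplitPrime π) (e : Exps) : mono π e ≠ 0 := by
  have h1 := map_ne_zero h.ne_zero conj
  have h2 := map_ne_zero h.ne_zero swap
  have h3 := map_ne_zero h2 conj
  exact mul_ne_zero (mul_ne_zero (pow_ne_zero _ h.ne_zero) (pow_ne_zero _ h1))
    (mul_ne_zero (pow_ne_zero _ h2) (pow_ne_zero _ h3))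

lemma multiplicity_mono (h : IsSplitPrime π) (e : Exps) : multiplicity π (mono π e) = e.1.1 := by
  apply multiplicity_eq_of_dvd_of_not_dvd
  · exact Dvd.intro _ (by rw [mono, mul_assoc])
  · rw [mono, mul_assoc, pow_succ, mul_dvd_mul_iff_left (pow_ne_zero _ h.ne_zero)]
    intro hd
    rcases h.prime.dvd_or_dvd hd with hd | hd
    · exact h.not_dvd_conj (h.prime.dvd_of_dvd_pow hd)
    rcases h.prime.dvd_or_dvd hd with hd | hd
    · exact h.not_dvd_swap (h.prime.dvd_of_dvd_pow hd)
    · exact h.not_dvd_conj_swap (h.prime.dvd_of_dvd_pow hd)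

/-- The multiplicities of the four conjugates of `π`. -/
def exps (π x : 𝓞 K) : Exps :=
  ((multiplicity π x, multiplicity π (conj x)),
    (multiplicity π (swap x), multiplicity π (conj (swap x))))

/-- The multiplicity of π in a conjugate of x is that of a conjugate prime in x. Equations between
monomials up to units thereby become equations between exponents. -/
lemma exps_mono (h : IsSplitPrime π) (e : Exps) : exps π (mono π e) = e := by
  simp only [exps, conj_mono, swap_mono, h.multiplicity_mono]
  rfl

lemma exps_mul (h : IsSplitPrime π) {x y : 𝓞 K} (hx : x ≠ 0) (hy : y ≠ 0) :
    exps π (x * y) = exps π x + exps π y := by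
  simp only [exps, map_mul]
  rw [h.mul hx hy, h.mul (map_ne_zero hx _) (map_ne_zero hy _),
    h.mul (map_ne_zero hx _) (map_ne_zero hy _),
    h.mul (map_ne_zero (map_ne_zero hx _) _) (map_ne_zero (map_ne_zero hy _) _)]
  rfl

lemma exps_unit (h : IsSplitPrime π) (u : (𝓞 K)ˣ) : exps π u = 0 := by
  have key : ∀ φ : 𝓞 K ≃+* 𝓞 K, multiplicity π (φ u) = 0 := fun φ =>
    multiplicity_of_isUnit_right h.prime.not_isUnit (u.isUnit.map φ)
  simp only [exps, h.unit, key]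
  rw [show multiplicity π (conj (swap (u : 𝓞 K))) = 0 from key (swap.trans conj)]
  rfl

/-- An automorphism permutes the exponents. -/
lemma map_mono (φ : 𝓞 K ≃+* 𝓞 K) : ∃ s : Exps → Exps,
    (s = id ∨ s = Exps.conj ∨ s = Exps.swap ∨ s = fun e => e.swap.conj) ∧
    ∀ π e, φ (mono π e) = mono π (s e) := by
  rcases ringEquiv_cases φ with h | h | h | h
  · exact ⟨id, by simp, fun π e => h _⟩
  · exact ⟨Exps.conj, by simp, fun π e => by rw [h, conj_mono]⟩
  · exact ⟨Exps.swap, by simp, fun π e => by rw [h, swap_mono]⟩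
  · exact ⟨fun e => e.swap.conj, by simp, fun π e => by rw [h, swap_mono, conj_mono]⟩

/-- Cosets of products of powers coincide when the exponents are permuted. -/
lemma coset_mono_eq_iff (h : IsSplitPrime π) (e e' : Exps) :
    coset (mono π e) = coset (mono π e') ↔
      e = e' ∨ e = e'.conj ∨ e = e'.swap ∨ e = e'.swap.conj := by
  constructor
  · intro he
    have : mono π e ∈ coset (mono π e') := he ▸ self_mem_coset _
    obtain ⟨φ, u, hu⟩ := this
    obtain ⟨s, hs, hφ⟩ := map_mono φ
    have := congrArg (exps π) hu
    rw [hφ, h.exps_mul (h.mono_ne_zero _) u.ne_zero, h.exps_unit, h.exps_mono, h.exps_mono,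
      add_zero] at this
    rcases hs with rfl | rfl | rfl | rfl <;> simp [this]
  · rintro (rfl | rfl | rfl | rfl)
    · rfl
    · rw [← conj_mono]; exact coset_eq_of_mem (map_mem_coset (self_mem_coset _) _)
    · rw [← swap_mono]; exact coset_eq_of_mem (map_mem_coset (self_mem_coset _) _)
    · rw [← conj_mono, ← swap_mono]
      exact coset_eq_of_mem (map_mem_coset (map_mem_coset (self_mem_coset _) _) _)

lemma map_prime (h : IsSplitPrime π) (φ : 𝓞 K ≃+* 𝓞 K) : Prime (φ π) :=
  (MulEquiv.prime_iff φ.toMulEquiv).mpr h.prime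

/-- A solution divides its own norm p^ρ, which is the product of the ρ-th powers of the four primes;
so it is a monomial up to a unit. -/
lemma solutionCosets_eq (h : IsSplitPrime π) {p : ℕ} (hp : 1 < p) (hN : Algebra.norm ℤ π = p)
    (ρ : ℕ) : solutionCosets ((p : ℤ) ^ ρ) =
      (fun e => coset (mono π e)) '' {e : Exps | e.1.1 + e.1.2 + (e.2.1 + e.2.2) = ρ} := by
  ext C
  constructor
  · rintro ⟨α, hα, rfl⟩
    have h1 : α ∣ mono π ((ρ, ρ), (ρ, ρ)) := by
      have e : mono π ((ρ, ρ), (ρ, ρ)) = (Algebra.norm ℤ π : 𝓞 K) ^ ρ := by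
        rw [coe_norm]
        simp only [mono, relNorm, map_mul, swap_conj, mul_pow]
      have e' : (Algebra.norm ℤ π : 𝓞 K) ^ ρ = ((Algebra.norm ℤ α : ℤ) : 𝓞 K) := by
        rw [hα, hN]; push_cast; rfl
      rw [e, e', coe_norm, relNorm, mul_assoc]
      exact dvd_mul_right _ _
    obtain ⟨x, y, hx, hy, rfl⟩ := exists_dvd_and_dvd_of_dvd_mul h1
    obtain ⟨x1, x2, hx1, hx2, rfl⟩ := exists_dvd_and_dvd_of_dvd_mul hx
    obtain ⟨y1, y2, hy1, hy2, rfl⟩ := exists_dvd_and_dvd_of_dvd_mul hy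
    obtain ⟨a, -, ha⟩ := (dvd_prime_pow h.prime _).mp hx1
    obtain ⟨b, -, hb⟩ := (dvd_prime_pow (h.map_prime conj) _).mp hx2
    obtain ⟨c, -, hc⟩ := (dvd_prime_pow (h.map_prime swap) _).mp hy1
    obtain ⟨d, -, hd⟩ := (dvd_prime_pow (h.map_prime (swap.trans conj)) _).mp hy2
    obtain ⟨u, hu⟩ := (ha.mul_mul hb).mul_mul (hc.mul_mul hd)
    have hm : x1 * x2 * (y1 * y2) * u = mono π ((a, b), (c, d)) := hu
    have hc : coset (mono π ((a, b), (c, d))) = coset (x1 * x2 * (y1 * y2)) := by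
      rw [← hm]
      exact coset_eq_of_mem (mul_unit_mem_coset (self_mem_coset _) u)
    refine ⟨((a, b), (c, d)), ?_, hc⟩
    have hn := norm_eq_of_mem_coset (hc ▸ self_mem_coset (mono π ((a, b), (c, d))))
    rw [hα, norm_mono, hN] at hn
    exact Nat.pow_right_injective hp (by exact_mod_cast hn)
  · rintro ⟨e, he, rfl⟩
    exact ⟨_, by rw [norm_mono, hN, he], rfl⟩

/-- The relative norm of a monomial has exponents ((a+b, a+b), (c+d, c+d)). Complex conjugation
fixes these, and `swap` exchanges the two sums. -/
lemma familyOf_mono_eq_iff (h : IsSplitPrime π) (e e' : Exps) :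
    familyOf (mono π e) = familyOf (mono π e') ↔
      (e.1.1 + e.1.2 = e'.1.1 + e'.1.2 ∧ e.2.1 + e.2.2 = e'.2.1 + e'.2.2) ∨
      (e.1.1 + e.1.2 = e'.2.1 + e'.2.2 ∧ e.2.1 + e.2.2 = e'.1.1 + e'.1.2) := by
  rw [familyOf_eq_iff (h.mono_ne_zero _) (h.mono_ne_zero _)]
  constructor
  · rintro ⟨γ, ⟨φ, u, rfl⟩, hr⟩
    obtain ⟨s, hs, hφ⟩ := map_mono φ
    have := congrArg (exps π) hr
    rw [hφ, relNorm_mul] at this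
    simp only [relNorm] at this
    have hu : conj (u : 𝓞 K) = (Units.map conj.toMonoidHom u : (𝓞 K)ˣ) := rfl
    rw [hu, conj_mono, conj_mono, h.exps_mul (mul_ne_zero (h.mono_ne_zero _) (h.mono_ne_zero _))
      (mul_ne_zero (Units.ne_zero _) (Units.ne_zero _)), h.exps_mul (Units.ne_zero _)
      (Units.ne_zero _), h.exps_unit, h.exps_unit, h.exps_mul (h.mono_ne_zero _)
      (h.mono_ne_zero _), h.exps_mul (h.mono_ne_zero _) (h.mono_ne_zero _)] at this
    simp only [h.exps_mono] at this
    obtain ⟨⟨a, b⟩, c, d⟩ := e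
    obtain ⟨⟨a', b'⟩, c', d'⟩ := e'
    rcases hs with rfl | rfl | rfl | rfl <;>
    simp [Exps.conj, Exps.swap] at this ⊢ <;> lia
  · rintro (⟨h1, h2⟩ | ⟨h1, h2⟩)
    · exact ⟨_, self_mem_coset _, by rw [relNorm_mono, relNorm_mono, h1, h2]⟩
    · refine ⟨_, map_mem_coset (self_mem_coset _) swap, ?_⟩
      rw [swap_mono, relNorm_mono, relNorm_mono, h1, h2]
      rfl

end IsSplitPrime

/-! ### Congruence in terms of exponents; Classes B1 and B2 -/

lemma GaussRelated.of_map_left {x y : 𝓞 K} (ψ : 𝓞 K ≃+* 𝓞 K) (h : GaussRelated (ψ x) y) :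
    GaussRelated x y := by
  obtain ⟨φ, u, a, b, h1, h2, h3, h4, h5⟩ := h
  have hs : ∀ x, swap (ψ.symm x) = ψ.symm (swap x) := fun x => by
    rcases ringEquiv_cases ψ.symm with h | h | h | h <;> simp only [h, swap_conj]
  refine ⟨φ.trans ψ.symm, Units.map ψ.symm.toMonoidHom u, ψ.symm a, ψ.symm b, by rw [hs, h1],
    by rw [hs, h2], (map_ne_zero_iff _ ψ.symm.injective).mpr h3, by rw [relNorm_map, relNorm_map, h4],
    ?_⟩
  have := congrArg ψ.symm h5
  simpa using this

lemma GaussRelated.of_mul_left {x y : 𝓞 K} (v : (𝓞 K)ˣ) (h : GaussRelated (x * v) y) :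
    GaussRelated x y := by
  obtain ⟨φ, u, a, b, h1, h2, h3, h4, h5⟩ := h
  refine ⟨φ, u * v⁻¹, a, b, h1, h2, h3, h4, ?_⟩
  rw [Units.val_mul]
  calc x * a = x * v * a * (v⁻¹ : (𝓞 K)ˣ) := by
        rw [mul_right_comm x, Units.mul_inv_cancel_right]
    _ = _ := by rw [h5]; ring

lemma GaussRelated.of_mul_right {x y : 𝓞 K} (v : (𝓞 K)ˣ) (h : GaussRelated x (y * v)) :
    GaussRelated x y := by
  obtain ⟨φ, u, a, b, h1, h2, h3, h4, h5⟩ := h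
  refine ⟨φ, Units.map φ.toMonoidHom v * u, a, b, h1, h2, h3, h4, ?_⟩
  rw [h5]
  simp [mul_assoc]

lemma gaussRelated_of_congr_of_mem_coset {x y α β : 𝓞 K} (hx : x ≠ 0) (hα : α ∈ coset x)
    (hβ : β ∈ coset y) (h : (tri α).Congr (tri β)) : GaussRelated x y := by
  have := gaussRelated_of_congr (ne_zero_of_mem_coset hx hα) h
  obtain ⟨φ, u, rfl⟩ := hα
  obtain ⟨ψ, v, rfl⟩ := hβ
  exact ((this.of_mul_right v).of_ringEquiv ψ).of_mul_left u |>.of_map_left φ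

/-- A Gaussian integer, being fixed by `swap`, has equal multiplicities at π and `swap π`, and
likewise at their complex conjugates. Equal relative norms give x + x' = y + y', so e − e'' = (t,
−t, t, −t) with t = y − x. -/
lemma IsSplitPrime.exps_of_gaussRelated {π : 𝓞 K} (h : IsSplitPrime π) {e e' : Exps}
    (hr : GaussRelated (mono π e) (mono π e')) :
    ∃ e'', (e'' = e' ∨ e'' = e'.conj ∨ e'' = e'.swap ∨ e'' = e'.swap.conj) ∧
      ∃ x x' y y' : ℕ, x + x' = y + y' ∧ e.1.1 + x = e''.1.1 + y ∧ e.1.2 + x' = e''.1.2 + y' ∧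
        e.2.1 + x = e''.2.1 + y ∧ e.2.2 + x' = e''.2.2 + y' := by
  obtain ⟨φ, u, a, b, h1, h2, h3, h4, h5⟩ := hr
  have hb : b ≠ 0 := by
    rintro rfl
    exact relNorm_ne_zero h3 (by rw [h4]; simp [relNorm])
  obtain ⟨s, hs, hφ⟩ := IsSplitPrime.map_mono φ
  have := congrArg (IsSplitPrime.exps π) h5
  rw [hφ, h.exps_mul (h.mono_ne_zero _) h3, h.exps_mul (mul_ne_zero (h.mono_ne_zero _)
    u.ne_zero) hb, h.exps_mul (h.mono_ne_zero _) u.ne_zero, h.exps_mono, h.exps_mono,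
    h.exps_unit, add_zero] at this
  have h6 := congrArg (multiplicity π) h4
  rw [relNorm, relNorm, h.mul h3 (map_ne_zero h3 _), h.mul hb (map_ne_zero hb _)] at h6
  refine ⟨s e', ?_, _, _, _, _, h6, ?_⟩
  · rcases hs with rfl | rfl | rfl | rfl <;> simp
  · simp only [IsSplitPrime.exps, h1, h2] at this
    obtain ⟨⟨e1, e2⟩, e3, e4⟩ := e
    generalize s e' = e' at *
    obtain ⟨⟨e1', e2'⟩, e3', e4'⟩ := e'
    simp only [Prod.mk_add_mk, Prod.mk.injEq] at this
    tauto

open Triangle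

namespace IsSplitPrime

variable {π : 𝓞 K}

lemma coset_mono_mem_familyOf (h : IsSplitPrime π) {e e' : Exps}
    (h1 : e'.1.1 + e'.1.2 = e.1.1 + e.1.2) (h2 : e'.2.1 + e'.2.2 = e.2.1 + e.2.2) :
    coset (mono π e') ∈ familyOf (mono π e) :=
  ⟨⟨_, h.mono_ne_zero _, rfl⟩, _, self_mem_coset _, by rw [relNorm_mono, relNorm_mono, h1, h2]⟩

lemma exists_eq_of_mem_familyOf (h : IsSplitPrime π) {p : ℕ} (hp : 1 < p)
    (hN : Algebra.norm ℤ π = p) {e : Exps} {C : Set (𝓞 K)} (hC : C ∈ familyOf (mono π e)) :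
    ∃ e' : Exps, C = coset (mono π e') ∧ e'.1.1 + e'.1.2 = e.1.1 + e.1.2 ∧
      e'.2.1 + e'.2.2 = e.2.1 + e.2.2 := by
  have h1 := familyOf_subset_solutionCosets (by rw [norm_mono, hN]) hC
  rw [h.solutionCosets_eq hp hN] at h1
  obtain ⟨e', he', rfl⟩ := h1
  have h2 := (isFamily_familyOf (h.mono_ne_zero e)).eq_familyOf hC
  rw [h.familyOf_mono_eq_iff] at h2
  rcases h2 with ⟨h3, h4⟩ | ⟨h3, h4⟩
  · exact ⟨e', rfl, h3.symm, h4.symm⟩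
  · exact ⟨e'.swap, (h.coset_mono_eq_iff _ _).mpr (Or.inr (Or.inr (Or.inl rfl))), h3.symm, h4.symm⟩

lemma exists_familyOf_eq (h : IsSplitPrime π) {p : ℕ} (hp : 1 < p)
    (hN : Algebra.norm ℤ π = p) {ρ : ℕ} {α : 𝓞 K} (hα : Algebra.norm ℤ α = (p : ℤ) ^ ρ) :
    ∃ s ≤ ρ / 2, familyOf α = familyOf (mono π ((ρ - s, 0), (s, 0))) := by
  have h1 : coset α ∈ solutionCosets ((p : ℤ) ^ ρ) := ⟨α, hα, rfl⟩
  rw [h.solutionCosets_eq hp hN] at h1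
  obtain ⟨e, he, hc⟩ := h1
  simp only [Set.mem_ofPred_eq] at he
  have hα1 : α ∈ coset (mono π e) := by
    rw [show coset (mono π e) = coset α from hc]
    exact self_mem_coset α
  have hα0 := ne_zero_of_mem_coset (h.mono_ne_zero e) hα1
  have h2 : familyOf α = familyOf (mono π e) :=
    (familyOf_eq_iff hα0 (h.mono_ne_zero e)).mpr ⟨α, hα1, rfl⟩
  by_cases hle : e.1.1 + e.1.2 ≤ ρ / 2
  · refine ⟨_, hle, h2.trans ((h.familyOf_mono_eq_iff _ _).mpr (Or.inr ⟨?_, ?_⟩))⟩ <;>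
    dsimp only <;> lia
  · refine ⟨e.2.1 + e.2.2, by lia, h2.trans ((h.familyOf_mono_eq_iff _ _).mpr (Or.inl ⟨?_, ?_⟩))⟩ <;>
    dsimp only <;> lia

lemma solutionFamilies_eq_image (h : IsSplitPrime π) {p : ℕ} (hp : 1 < p)
    (hN : Algebra.norm ℤ π = p) (ρ : ℕ) : solutionFamilies ((p : ℤ) ^ ρ) =
      (fun s => familyOf (mono π ((ρ - s, 0), (s, 0)))) '' (Finset.range (ρ / 2 + 1) : Set ℕ) := by
  rw [solutionFamilies_eq (pow_ne_zero _ (by lia))]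
  ext F
  simp only [Set.mem_ofPred_eq, Set.mem_image, Finset.coe_range, Set.mem_Iio]
  constructor
  · rintro ⟨α, hα, rfl⟩
    obtain ⟨s, hs, e⟩ := h.exists_familyOf_eq hp hN hα
    exact ⟨s, by lia, e.symm⟩
  · rintro ⟨s, hs, rfl⟩
    refine ⟨_, ?_, rfl⟩
    rw [norm_mono, hN]
    congr 1
    dsimp only
    lia

lemma familyOf_injOn (h : IsSplitPrime π) (ρ : ℕ) :
    Set.InjOn (fun s => familyOf (mono π ((ρ - s, 0), (s, 0))))
      (Finset.range (ρ / 2 + 1) : Set ℕ) := by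
  intro s hs t ht e
  have := (h.familyOf_mono_eq_iff _ _).mp e
  simp only [Finset.coe_range, Set.mem_Iio] at hs ht
  dsimp only at this
  lia

lemma isClassB1_familyOf (h : IsSplitPrime π) {p : ℕ} (hp : 1 < p)
    (hN : Algebra.norm ℤ π = p) {ρ : ℕ} (hρ : 2 ≤ ρ) :
    IsClassB1 (familyOf (mono π ((ρ, 0), (0, 0)))) ∧
      ¬ IsClassB2 (familyOf (mono π ((ρ, 0), (0, 0)))) := by
  apply (isFamily_familyOf (h.mono_ne_zero _)).isClassB1
  -- For ρ = 1 these two cosets would be conjugate, hence equal.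
  · refine ⟨_, coset_mem_familyOf (h.mono_ne_zero _), coset (mono π ((ρ - 1, 1), (0, 0))),
      h.coset_mono_mem_familyOf (by dsimp only; lia) (by dsimp only), ?_⟩
    rw [Ne, h.coset_mono_eq_iff]
    simp only [Exps.conj, Exps.swap, Prod.mk.injEq]
    lia
  · intro C hC C' hC' α hα β hβ hc
    obtain ⟨e, rfl, he1, he2⟩ := h.exists_eq_of_mem_familyOf hp hN hC
    obtain ⟨e', rfl, he1', he2'⟩ := h.exists_eq_of_mem_familyOf hp hN hC'
    obtain ⟨e'', h1, x, x', y, y', h2⟩ := h.exps_of_gaussRelated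
      (gaussRelated_of_congr_of_mem_coset (h.mono_ne_zero _) hα hβ hc)
    rw [h.coset_mono_eq_iff]
    obtain ⟨⟨a, b⟩, c, d⟩ := e
    obtain ⟨⟨a', b'⟩, c', d'⟩ := e'
    simp only [Exps.conj, Exps.swap, Prod.mk.injEq] at *
    -- The second pair of exponents is zero on both sides, which forces t = 0 when e'' is `e'` or
    -- its conjugate. Swapped exponents would require the total ρ to vanish.
    rcases h1 with rfl | rfl | rfl | rfl <;> dsimp only at h2 <;> lia

/-- Conjugating if necessary, an element of a coset is a unit times a conjugate over `ℤ[i]`. -/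
lemma exists_sides_eq {x γ : 𝓞 K} (hγ : γ ∈ coset x) : ∃ u : (𝓞 K)ˣ,
    (sides γ = sides (x * u) ∧ relNorm γ = relNorm (x * u)) ∨
    (sides γ = sides (swap x * u) ∧ relNorm γ = relNorm (swap x * u)) := by
  obtain ⟨φ, u, rfl⟩ := hγ
  have hc : ∀ y, sides (conj y * u) = sides (y * (Units.map conj.toMonoidHom u : (𝓞 K)ˣ)) ∧
      relNorm (conj y * u) = relNorm (y * (Units.map conj.toMonoidHom u : (𝓞 K)ˣ)) := fun y => by
    have : conj y * u = conj (y * (Units.map conj.toMonoidHom u : (𝓞 K)ˣ)) := by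
      rw [map_mul, show ((Units.map conj.toMonoidHom u : (𝓞 K)ˣ) : 𝓞 K) = conj u from rfl,
        conj_conj]
    rw [this, sides_conj, relNorm_conj]
    exact ⟨rfl, rfl⟩
  rcases ringEquiv_cases φ with h | h | h | h <;> rw [h]
  · exact ⟨u, Or.inl ⟨rfl, rfl⟩⟩
  · exact ⟨_, Or.inl (hc x)⟩
  · exact ⟨u, Or.inr ⟨rfl, rfl⟩⟩
  · exact ⟨_, Or.inr (hc _)⟩

lemma sides_mul_unit_eq {x y q : 𝓞 K} {u v : (𝓞 K)ˣ} (hq : swap q = q) (hq0 : q ≠ 0)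
    (hx0 : x ≠ 0) (h : x * conj q = q * y) (hr : relNorm (x * u) = relNorm (y * v)) :
    sides (x * u) = sides (y * v) := by
  have hxy : relNorm x = relNorm y := by
    have e := congrArg relNorm h
    rw [relNorm_mul, relNorm_mul, relNorm_conj, mul_comm (relNorm q)] at e
    exact mul_right_cancel₀ (relNorm_ne_zero hq0) e
  rw [relNorm_mul, relNorm_mul, ← hxy] at hr
  have huv := mul_left_cancel₀ (relNorm_ne_zero hx0) hr
  -- The units have equal relative norms, so their quotient has relative norm 1.
  refine sides_eq_of_mul_conj_eq (w := (u * v⁻¹ : (𝓞 K)ˣ)) hq hq0 ?_ ?_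
  · rw [Units.val_mul, relNorm_mul, huv, ← relNorm_mul, Units.mul_inv]
    simp [relNorm]
  · rw [Units.val_mul]
    calc x * u * conj q = q * y * u := by rw [← h]; ring
      _ = q * y * u * (v * (v⁻¹ : (𝓞 K)ˣ)) := by rw [Units.mul_inv, mul_one]
      _ = _ := by ring

/-- Elements of two particular cosets with equal relative norms have congruent triangles. -/
lemma congr_of_relNorm_eq (h : IsSplitPrime π) {s t : ℕ} {α β : 𝓞 K}
    (hα : α ∈ coset (mono π ((s + 1, 0), (t + 1, 0)))) (hβ : β ∈ coset (mono π ((s, 1), (t, 1))))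
    (hr : relNorm α = relNorm β) : (tri α).Congr (tri β) := by
  set x := mono π ((s + 1, 0), (t + 1, 0)) with hx
  set y := mono π ((s, 1), (t, 1)) with hy
  -- Fixed by `swap`, so a Gaussian integer. Multiplication by q̄/q trades one π and one `swap π`
  -- for their complex conjugates, which turns x into y.
  let q := π * swap π
  have hq : swap q = q := by simp only [q, map_mul, swap_swap]; ring
  have hq0 : q ≠ 0 := mul_ne_zero h.ne_zero (map_ne_zero h.ne_zero _)
  have hx0 : x ≠ 0 := h.mono_ne_zero _
  have hy0 : y ≠ 0 := h.mono_ne_zero _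
  have hxy : x * conj q = q * y := by
    simp only [hx, hy, mono, q, map_mul]; ring
  have hxy' : swap x * conj q = q * swap y := by
    have := congrArg swap hxy
    rwa [map_mul, map_mul swap q, swap_conj, hq] at this
  have hr0 : relNorm x = relNorm y := by
    rw [hx, hy, relNorm_mono, relNorm_mono]
    rfl
  -- When the automorphisms for α and β differ by `swap`, equal relative norms force the two
  -- exponent sums to agree. Then s = t, x is fixed, and the mixed cases reduce to the others.
  have hst : ∀ u v : (𝓞 K)ˣ, relNorm (x * u) = relNorm (swap y * v) → swap x = x := by
    intro u v e
    have := congrArg (exps π) e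
    simp only [relNorm_mul, relNorm_swap] at this
    rw [← hr0, hx, ← relNorm_swap, swap_mono] at this
    simp only [relNorm, conj_mono] at this
    have hu : ∀ u : (𝓞 K)ˣ, conj (u : 𝓞 K) = (Units.map conj.toMonoidHom u : (𝓞 K)ˣ) :=
      fun _ => rfl
    have hm := h.mono_ne_zero
    rw [hu, hu, h.exps_mul (mul_ne_zero (hm _) (hm _)) (mul_ne_zero u.ne_zero (Units.ne_zero _)),
      h.exps_mul (mul_ne_zero (hm _) (hm _)) (mul_ne_zero v.ne_zero (Units.ne_zero _)),
      h.exps_mul u.ne_zero (Units.ne_zero _), h.exps_mul v.ne_zero (Units.ne_zero _),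
      h.exps_unit, h.exps_unit, h.exps_unit, h.exps_unit, h.exps_mul (hm _) (hm _),
      h.exps_mul (hm _) (hm _)] at this
    simp only [h.exps_mono] at this
    have : s = t := by
      simp [Exps.conj, Exps.swap] at this
      lia
    rw [hx, swap_mono, this]
    rfl
  obtain ⟨u, hu⟩ := exists_sides_eq hα
  obtain ⟨v, hv⟩ := exists_sides_eq hβ
  change sides α = sides β
  have hs := swap_swap x
  rcases hu with ⟨hu1, hu2⟩ | ⟨hu1, hu2⟩ <;> rcases hv with ⟨hv1, hv2⟩ | ⟨hv1, hv2⟩ <;>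
    rw [hu1, hv1] <;> rw [hu2, hv2] at hr
  · exact sides_mul_unit_eq hq hq0 hx0 hxy hr
  · have hsx := hst u v hr
    rw [← hsx] at hr ⊢
    exact sides_mul_unit_eq hq hq0 (map_ne_zero hx0 _) hxy' hr
  · have : swap x = x := hst (Units.map swap.toMonoidHom u) (Units.map swap.toMonoidHom v) (by
      have e := congrArg swap hr
      rw [← relNorm_swap, ← relNorm_swap, map_mul, map_mul, swap_swap] at e
      exact e)
    rw [this] at hr ⊢
    exact sides_mul_unit_eq hq hq0 hx0 hxy hr
  · exact sides_mul_unit_eq hq hq0 (map_ne_zero hx0 _) hxy' hr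

lemma isClassB2_familyOf (h : IsSplitPrime π) {s t : ℕ} (hst : 1 ≤ s + t) :
    IsClassB2 (familyOf (mono π ((s + 1, 0), (t + 1, 0)))) ∧
      ¬ IsClassB1 (familyOf (mono π ((s + 1, 0), (t + 1, 0)))) := by
  refine (isFamily_familyOf (h.mono_ne_zero _)).isClassB2 (coset_mem_familyOf (h.mono_ne_zero _))
    (h.coset_mono_mem_familyOf (e' := ((s, 1), (t, 1))) rfl rfl)
    (h.coset_mono_mem_familyOf (e' := ((s + 1, 0), (0, t + 1))) rfl (zero_add _)) ?_
    (fun α hα β hβ => h.congr_of_relNorm_eq hα hβ) ?_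
  -- Only s = t = 0 would make the two exponents conjugate.
  · rw [Ne, h.coset_mono_eq_iff]
    simp only [Exps.conj, Exps.swap, Prod.mk.injEq]
    lia
  -- The shift preserves (a−b) − (c−d), and the symmetries change at most its sign. It is s − t here
  -- and s + t + 2 for the third coset.
  · intro α hα β hβ hc
    obtain ⟨e'', h1, x, x', y, y', h2⟩ := h.exps_of_gaussRelated
      (gaussRelated_of_congr_of_mem_coset (h.mono_ne_zero _) hα hβ hc)
    simp only [Exps.conj, Exps.swap] at h1
    rcases h1 with rfl | rfl | rfl | rfl <;> dsimp only at h2 <;> lia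

end IsSplitPrime

/-! ### Counting orbits of exponents -/

/-- The exponents with sum `ρ`. -/
def expsFinset (ρ : ℕ) : Finset Exps :=
  (antidiagonal ρ).biUnion fun st => antidiagonal st.1 ×ˢ antidiagonal st.2

lemma mem_expsFinset {ρ : ℕ} {e : Exps} :
    e ∈ expsFinset ρ ↔ e.1.1 + e.1.2 + (e.2.1 + e.2.2) = ρ := by
  simp [expsFinset]

lemma card_expsFinset (ρ : ℕ) :
    ((expsFinset ρ).card : ℚ) = (ρ + 1) * (ρ + 2) * (ρ + 3) / 6 := by
  have h1 : (expsFinset ρ).card = ∑ st ∈ antidiagonal ρ, (st.1 + 1) * (st.2 + 1) := by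
    rw [expsFinset, Finset.card_biUnion]
    · simp
    · intro st _ st' _ hne
      rw [Function.onFun, Finset.disjoint_left]
      intro e he he'
      simp only [Finset.mem_product, mem_antidiagonal] at he he'
      exact hne (Prod.ext (he.1.symm.trans he'.1) (he.2.symm.trans he'.2))
  have h2 : ∀ n : ℕ, ∑ s ∈ Finset.range n, ((s : ℚ) + 1) * (ρ - s + 1) =
      (ρ + 2) * (n * (n + 1) / 2) - n * (n + 1) * (2 * n + 1) / 6 := fun n => by
    induction n with
    | zero => simp
    | succ n ih => rw [Finset.sum_range_succ, ih]; push_cast; ring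
  rw [h1, Finset.Nat.sum_antidiagonal_eq_sum_range_succ_mk]
  push_cast
  calc _ = ∑ s ∈ Finset.range (ρ + 1), ((s : ℚ) + 1) * (ρ - s + 1) := by
        refine Finset.sum_congr rfl fun s hs => ?_
        rw [Nat.cast_sub (by simpa [Nat.lt_succ_iff] using hs)]
    _ = _ := by rw [h2]; push_cast; ring

/-- Common count for the three involutions: their fixed exponents are parametrised by pairs with
half the total, so there are ρ/2 + 1 for even ρ and none for odd ρ. -/
lemma card_filter_expsFinset (ρ : ℕ) (f : ℕ × ℕ → Exps) (hf : Function.Injective f)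
    (hs : ∀ x, (f x).1.1 + (f x).1.2 + ((f x).2.1 + (f x).2.2) = 2 * (x.1 + x.2))
    (P : Exps → Prop) [DecidablePred P] (hP : ∀ e, P e ↔ ∃ x, f x = e) :
    (((expsFinset ρ).filter P).card : ℚ) = (1 + (-1) ^ ρ) / 2 * (ρ / 2 + 1) := by
  rcases Nat.even_or_odd' ρ with ⟨n, rfl | rfl⟩
  · have : (expsFinset (2 * n)).filter P = (antidiagonal n).image f := by
      ext e
      simp only [Finset.mem_filter, mem_expsFinset, hP, Finset.mem_image, mem_antidiagonal]
      constructor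
      · rintro ⟨h1, x, rfl⟩
        have := hs x
        exact ⟨x, by lia, rfl⟩
      · rintro ⟨x, hx, rfl⟩
        exact ⟨by rw [hs, hx], x, rfl⟩
    rw [this, Finset.card_image_of_injective _ hf, Finset.Nat.card_antidiagonal, pow_mul]
    push_cast
    norm_num
  · have : (expsFinset (2 * n + 1)).filter P = ∅ := by
      rw [Finset.filter_eq_empty_iff]
      intro e he hPe
      obtain ⟨x, rfl⟩ := (hP e).mp hPe
      rw [mem_expsFinset, hs] at he
      lia
    rw [this, pow_succ, pow_mul]
    norm_num

/-- The number of symmetries that fix the exponents. -/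
def stabilizerCard (e : Exps) : ℕ :=
  1 + (if e.conj = e then 1 else 0) + (if e.swap = e then 1 else 0) +
    (if e.swap.conj = e then 1 else 0)

lemma sum_stabilizerCard (ρ : ℕ) : ((∑ e ∈ expsFinset ρ, stabilizerCard e : ℕ) : ℚ) =
    (ρ + 2) * (2 * ρ ^ 2 + 8 * ρ + 15 + 9 * (-1) ^ ρ) / 12 := by
  simp only [stabilizerCard, Finset.sum_add_distrib, ← Finset.card_filter, Finset.sum_const,
    smul_eq_mul, mul_one]
  push_cast
  rw [card_expsFinset,
    card_filter_expsFinset ρ (fun x => ((x.1, x.1), (x.2, x.2))) (fun x y h => by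
      simp only [Prod.mk.injEq] at h; exact Prod.ext h.1.1 h.2.1) (fun x => by dsimp only; ring)
      (fun e => e.conj = e) ?_,
    card_filter_expsFinset ρ (fun x => (x, x)) (fun x y h => (Prod.mk.inj h).1)
      (fun x => by dsimp only; ring) (fun e => e.swap = e) ?_,
    card_filter_expsFinset ρ (fun x => (x, (x.2, x.1))) (fun x y h => (Prod.mk.inj h).1)
      (fun x => by dsimp only; ring) (fun e => e.swap.conj = e) ?_]
  · ring
  all_goals
    rintro ⟨⟨a, b⟩, c, d⟩
    simp only [Exps.conj, Exps.swap, Prod.mk.injEq, Prod.exists]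
    constructor
    · intro h
      first
      | exact ⟨a, c, by lia⟩
      | exact ⟨a, b, by lia⟩
    · rintro ⟨x, y, h⟩
      lia

-- Orbit–stabiliser for the Klein four-group, by cases on which symmetries fix `e`; the set notation
-- merges coinciding images.
set_option maxHeartbeats 1000000 in
lemma sum_stabilizerCard_orbit (e : Exps) :
    ∑ e' ∈ ({e, e.conj, e.swap, e.swap.conj} : Finset Exps), stabilizerCard e' = 4 := by
  have pair : ∀ x y : Exps, ({e, e.conj, e.swap, e.swap.conj} : Finset Exps) = {x, y} →
      x ≠ y → stabilizerCard x + stabilizerCard y = 4 →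
      ∑ e' ∈ ({e, e.conj, e.swap, e.swap.conj} : Finset Exps), stabilizerCard e' = 4 := by
    intro x y h hne h4
    rw [h, Finset.sum_pair hne, h4]
  have four : ∀ x y z w : Exps, x ≠ y → x ≠ z → x ≠ w → y ≠ z → y ≠ w → z ≠ w →
      ∑ e' ∈ ({x, y, z, w} : Finset Exps), stabilizerCard e' =
        stabilizerCard x + (stabilizerCard y + (stabilizerCard z + stabilizerCard w)) := by
    intro x y z w h1 h2 h3 h4 h5 h6
    rw [Finset.sum_insert (by simp [h1, h2, h3]), Finset.sum_insert (by simp [h4, h5]),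
      Finset.sum_pair h6]
  have mem : ∀ x y z w v : Exps, v ∈ ({x, y, z, w} : Finset Exps) ↔
      v = x ∨ v = y ∨ v = z ∨ v = w := by simp
  have mem2 : ∀ x y v : Exps, v ∈ ({x, y} : Finset Exps) ↔ v = x ∨ v = y := by simp
  obtain ⟨⟨a, b⟩, c, d⟩ := e
  have card : ∀ a b c d, stabilizerCard ((a, b), (c, d)) =
      1 + (if b = a ∧ d = c then 1 else 0) + (if c = a ∧ d = b then 1 else 0) +
      (if d = a ∧ c = b then 1 else 0) := fun a b c d => by
    simp only [stabilizerCard, Exps.conj, Exps.swap, Prod.mk.injEq]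
    have e1 : ((b = a ∧ a = b) ∧ d = c ∧ c = d) ↔ b = a ∧ d = c := by tauto
    have e2 : ((c = a ∧ d = b) ∧ a = c ∧ b = d) ↔ c = a ∧ d = b := by tauto
    have e3 : ((d = a ∧ c = b) ∧ b = c ∧ a = d) ↔ d = a ∧ c = b := by tauto
    simp only [e1, e2, e3]
  by_cases h1 : a = b ∧ c = d
  · obtain ⟨rfl, rfl⟩ := h1
    by_cases h2 : a = c
    · subst h2
      have : ({((a, a), (a, a)), Exps.conj ((a, a), (a, a)), Exps.swap ((a, a), (a, a)),
          (Exps.swap ((a, a), (a, a))).conj} : Finset Exps) = {((a, a), (a, a))} := by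
        ext v
        rw [mem, Finset.mem_singleton]
        simp only [Exps.conj, Exps.swap, or_self]
      rw [this, Finset.sum_singleton, card]
      simp
    · refine pair ((a, a), (c, c)) ((c, c), (a, a)) ?_ ?_ ?_
      · ext v
        rw [mem, mem2]
        simp only [Exps.conj, Exps.swap]
        tauto
      · simp only [Ne, Prod.mk.injEq]; lia
      · rw [card, card]; split_ifs <;> lia
  have h2 : ¬ (a = c ∧ b = d) ∨ (a = c ∧ b = d) := by tauto
  rcases h2 with h3 | ⟨rfl, rfl⟩
  · by_cases h4 : a = d ∧ b = c
    · obtain ⟨rfl, rfl⟩ := h4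
      refine pair ((a, b), (b, a)) ((b, a), (a, b)) ?_ ?_ ?_
      · ext v
        rw [mem, mem2]
        simp only [Exps.conj, Exps.swap]
        tauto
      · simp only [Ne, Prod.mk.injEq]; lia
      · rw [card, card]; split_ifs <;> lia
    · simp only [Exps.conj, Exps.swap]
      rw [four]
      · have p1 : ¬ (b = a ∧ d = c) := by lia
        have p2 : ¬ (c = a ∧ d = b) := by lia
        have p3 : ¬ (d = a ∧ c = b) := by lia
        have p4 : ¬ (a = b ∧ c = d) := by lia
        have p5 : ¬ (a = c ∧ b = d) := by lia
        have p6 : ¬ (a = d ∧ b = c) := by lia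
        have p7 : ¬ (c = b ∧ d = a) := by lia
        have p8 : ¬ (d = b ∧ c = a) := by lia
        have p9 : ¬ (d = c ∧ b = a) := by lia
        have p10 : ¬ (c = d ∧ a = b) := by lia
        have p11 : ¬ (b = c ∧ a = d) := by lia
        have p12 : ¬ (b = d ∧ a = c) := by lia
        simp only [card, p1, p2, p3, p4, p5, p6, p7, p8, p9, p10, p11, p12, if_false]
      all_goals
        simp only [Ne, Prod.mk.injEq]
        clear pair four mem mem2 card
        lia
  · refine pair ((a, b), (a, b)) ((b, a), (b, a)) ?_ ?_ ?_
    · ext v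
      rw [mem, mem2]
      simp only [Exps.conj, Exps.swap]
      tauto
    · simp only [Ne, Prod.mk.injEq]; lia
    · rw [card, card]; split_ifs <;> lia

-- Burnside's count: each coset is the image of one orbit of exponents, and each orbit contributes 4
-- to the sum of the stabiliser orders.
open Classical in
lemma four_mul_card_image {π : 𝓞 K} (h : IsSplitPrime π) (ρ : ℕ) :
    4 * ((expsFinset ρ).image fun e => coset (mono π e)).card =
      ∑ e ∈ expsFinset ρ, stabilizerCard e := by
  rw [← Finset.sum_fiberwise_of_maps_to (g := fun e => coset (mono π e))
    (t := (expsFinset ρ).image fun e => coset (mono π e)) fun e he => Finset.mem_image_of_mem _ he]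
  rw [Finset.sum_const_nat (m := 4), mul_comm]
  intro C hC
  obtain ⟨e, he, rfl⟩ := Finset.mem_image.mp hC
  rw [← sum_stabilizerCard_orbit e]
  congr 1
  ext e'
  rw [Finset.mem_filter, h.coset_mono_eq_iff]
  simp only [Finset.mem_insert, Finset.mem_singleton]
  refine ⟨fun h => h.2, fun h => ⟨?_, h⟩⟩
  rw [mem_expsFinset] at he ⊢
  rcases h with rfl | rfl | rfl | rfl
  · exact he
  all_goals
    dsimp only [Exps.conj, Exps.swap]
    lia

end

end LatticeTriangles

theorem theorem10 (p ρ : ℕ) (hp : p.Prime) (hp12 : p % 12 = 1) (hρ : 2 < ρ) :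
    -- the number of solution cosets
    (LatticeTriangles.solutionCosets ((p : ℤ) ^ ρ)).Finite ∧
    ((LatticeTriangles.solutionCosets ((p : ℤ) ^ ρ)).ncard : ℚ) =
      ((ρ : ℚ) + 2) * (2 * (ρ : ℚ) ^ 2 + 8 * (ρ : ℚ) + 15 + 9 * (-1) ^ ρ) / 48 ∧
    -- they are partitioned into families
    (∀ F ∈ LatticeTriangles.solutionFamilies ((p : ℤ) ^ ρ), F.Nonempty) ∧
    (LatticeTriangles.solutionFamilies ((p : ℤ) ^ ρ)).PairwiseDisjoint id ∧
    ⋃₀ LatticeTriangles.solutionFamilies ((p : ℤ) ^ ρ) =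
      LatticeTriangles.solutionCosets ((p : ℤ) ^ ρ) ∧
    -- the number of families
    (LatticeTriangles.solutionFamilies ((p : ℤ) ^ ρ)).Finite ∧
    (LatticeTriangles.solutionFamilies ((p : ℤ) ^ ρ)).ncard = ρ / 2 + 1 ∧
    -- one family is of Class B1 and the remaining ones are of Class B2
    ∃ F₁ ∈ LatticeTriangles.solutionFamilies ((p : ℤ) ^ ρ),
      (LatticeTriangles.IsClassB1 F₁ ∧ ¬ LatticeTriangles.IsClassB2 F₁) ∧
      ∀ F ∈ LatticeTriangles.solutionFamilies ((p : ℤ) ^ ρ), F ≠ F₁ →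
        LatticeTriangles.IsClassB2 F ∧ ¬ LatticeTriangles.IsClassB1 F := by
  classical
  open LatticeTriangles in
  obtain ⟨π, h, hN⟩ := exists_isSplitPrime hp hp12
  have hp1 := hp.one_lt
  have hr : (p : ℤ) ^ ρ ≠ 0 := pow_ne_zero _ (by lia)
  have hcosets : solutionCosets ((p : ℤ) ^ ρ) =
      (((expsFinset ρ).image fun e => coset (mono π e) : Finset (Set (𝓞 K))) :
        Set (Set (𝓞 K))) := by
    rw [h.solutionCosets_eq hp1 hN, Finset.coe_image]
    congr 1
    ext e
    simp [mem_expsFinset]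
  have hfam := h.solutionFamilies_eq_image hp1 hN ρ
  refine ⟨?_, ?_, fun F hF => hF.1.nonempty, ?_, ?_, ?_, ?_, familyOf (mono π ((ρ, 0), (0, 0))), ?_,
    h.isClassB1_familyOf hp1 hN hρ.le, ?_⟩
  · rw [hcosets]; exact Finset.finite_toSet _
  · rw [hcosets, Set.ncard_coe_finset]
    have h4 := four_mul_card_image h ρ
    have h5 := sum_stabilizerCard ρ
    rw [← h4] at h5
    push_cast at h5
    linear_combination h5 / 4
  · intro F hF F' hF' hne
    rw [Function.onFun, Set.disjoint_left]
    exact fun C hC hC' => hne (hF.1.eq_of_mem hF'.1 hC hC')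
  · refine Set.Subset.antisymm (Set.sUnion_subset fun F hF => hF.2) ?_
    rintro C ⟨α, hα, rfl⟩
    have hα0 : α ≠ 0 := fun h0 => hr (by rw [← hα, h0]; simp)
    refine ⟨familyOf α, ?_, coset_mem_familyOf hα0⟩
    rw [solutionFamilies_eq hr]
    exact ⟨α, hα, rfl⟩
  · rw [hfam]; exact (Finset.finite_toSet _).image _
  · rw [hfam, (h.familyOf_injOn ρ).ncard_image, Set.ncard_coe_finset,
      Finset.card_range]
  · rw [hfam]
    exact ⟨0, by simp, rfl⟩
  · intro F hF hne
    rw [hfam] at hF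
    obtain ⟨s, hs, rfl⟩ := hF
    simp only [Finset.coe_range, Set.mem_Iio] at hs
    -- The excluded family is that of s = 0, so both exponent sums are now positive.
    obtain ⟨t, rfl⟩ : ∃ t, s = t + 1 := Nat.exists_eq_succ_of_ne_zero (by rintro rfl; exact hne rfl)
    obtain ⟨k, hk⟩ : ∃ k, ρ - (t + 1) = k + 1 := ⟨ρ - (t + 1) - 1, by lia⟩
    simp only [hk]
    -- The condition needed is k + t = ρ − 2 ≥ 1, where ρ > 2 enters.
    exact h.isClassB2_familyOf (by lia)
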